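/- **Theorem (Nonconvergence).** Let $m\ge 3$, $B\ge 1$, $\eta,\lambda>0$ and $w_0\in\mathbb{R}^m\setminus\{0\}$. Let $x_{t,b}$ ($t\ge 0$, $1\le b\le B$) be i.i.d. $\mathcal N(0,I_m)$ inputs; the label of an input $x$ is $y=\mathrm{sgn}(x_1)$. For the last linear layer followed by normalization, with the logistic loss, put $$L_{BN}(w,x)=\ln\Big(1+\exp\Big(-y\,x^\top\frac{w}{\|w\|}\Big)\Big),$$ and let $w_t$ be the iterates of SGD with batch size $B$, constant learning rate $\eta$, weight decay $\lambda$ and no momentum, started at $w_0$: $$w_{t+1}=w_t-\frac{\eta}{B}\sum_{b=1}^{B}\nabla_w\Big(L_{BN}(w,x_{t,b})+\frac{\lambda}{2}\|w\|^2\Big)\Big|_{w=w_t}.$$ Let $\mathrm{err}(w)=\Pr_{x\sim\mathcal N(0,I_m)}[\,x^\top w\,\mathrm{sgn}(x_1)\le 0\,]$ be the training error. 1. For every $T_0\in\mathbb{N}$, every $\delta\in(0,1)$ and every $\varepsilon>0$ with $2\varepsilon^2<\eta\lambda$ and $\varepsilon\le\pi/4$ (the last condition is automatic when $\eta\lambda\le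 1$), put $$N=\left\lceil \max\Big\{0,\ \frac{1}{2(\eta\lambda-2\varepsilon^2)}\ln\frac{64\|w_{T_0}\|^2\varepsilon\sqrt B}{\eta\sqrt{m-2}}\Big\}+9\ln\frac1\delta\right\rceil .$$ Then, with probability at least $1-\delta$ over the samples, $\mathrm{err}(w_t)>\varepsilon/\pi$ for at least one $t\in\{T_0,T_0+1,\dots,T_0+N\}$. 2. Consequently SGD does not converge to error below order $\sqrt{\eta\lambda}$, whatever the batch size: almost surely $$\limsup_{t\to\infty}\ \mathrm{err}(w_t)\ \ge\ \frac1\pi\min\Big\{\sqrt{\eta\lambda/2},\ \frac{\pi}{4}\Big\},$$ where the minimum is $\sqrt{\eta\lambda/2}$ whenever $\eta\lambda\le 1$. -/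

import Mathlib

open MeasureTheory ProbabilityTheory Filter

/-- The label of an input: the sign of its first coordinate (the value `0` of `Real.sign` is only
taken on the Gaussian null set where the first coordinate vanishes). -/
noncomputable def label {m : ℕ} [NeZero m] (x : EuclideanSpace ℝ (Fin m)) : ℝ :=
  Real.sign (x 0)

/-- The logistic loss of the output `u` for the label `y`. -/
noncomputable def logisticLoss (u y : ℝ) : ℝ :=
  Real.log (1 + Real.exp (-(u * y)))

/-- The loss at the input `x` of the linear layer with weight `w` followed by normalization:
the output is `⟪x, w / ‖w‖⟫`. -/
noncomputable def bnLoss {m : ℕ} [NeZero m] (w x : EuclideanSpace ℝ (Fin m)) : ℝ :=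
  logisticLoss (inner ℝ x (‖w‖⁻¹ • w)) (label x)

/-- The training error of `w`: the probability, over a standard Gaussian input, that the
output has the wrong sign. -/
noncomputable def trainError {m : ℕ} [NeZero m] (w : EuclideanSpace ℝ (Fin m)) : ℝ :=
  (stdGaussian (EuclideanSpace ℝ (Fin m))).real {x | inner ℝ x w * label x ≤ 0}

/-- One step of SGD with learning rate `η` and weight decay `wd` on the batch `xs`: the average
over the batch of the gradients of the loss plus `(wd / 2) * ‖v‖ ^ 2`, taken at `w`, is
subtracted with factor `η`. -/
noncomputable def sgdStep {m B : ℕ} [NeZero m] (η wd : ℝ) (w : EuclideanSpace ℝ (Fin m))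
    (xs : Fin B → EuclideanSpace ℝ (Fin m)) : EuclideanSpace ℝ (Fin m) :=
  w - (η / B) • ∑ b, gradient (fun v => bnLoss v (xs b) + wd / 2 * ‖v‖ ^ 2) w

/-- The iterates of SGD started at `w₀`, where `xs t` is the batch used in iteration `t`. -/
noncomputable def sgdIterate {m B : ℕ} [NeZero m] (η wd : ℝ) (w₀ : EuclideanSpace ℝ (Fin m))
    (xs : ℕ → Fin B → EuclideanSpace ℝ (Fin m)) : ℕ → EuclideanSpace ℝ (Fin m)
  | 0 => w₀
  | t + 1 => sgdStep η wd (sgdIterate η wd w₀ xs t) (xs t)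

/-- The number of iterations, rounded up:
`max 0 (1 / (2 (η wd - 2 ε²)) * ln (64 ‖w‖² ε √B / (η √(m - 2)))) + 9 ln (1 / δ)`. -/
noncomputable def escapeIterations (m B : ℕ) (η wd ε δ : ℝ)
    (w : EuclideanSpace ℝ (Fin m)) : ℕ :=
  ⌈max 0 (1 / (2 * (η * wd - 2 * ε ^ 2)) *
      Real.log (64 * ‖w‖ ^ 2 * ε * √(B : ℝ) / (η * √((m : ℝ) - 2)))) +
    9 * Real.log (1 / δ)⌉₊

/-! The loss depends only on the direction of `w`, so its gradient is orthogonal to `w` and scales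
like `1 / ‖w‖`. A step is therefore a radial shrinking by `1 - η * wd` plus an orthogonal kick of
length `η * ‖batchDescent w xs‖ / ‖w‖` (`sgdStep_eq`), and relative to `‖w‖` the kick grows as the
norm decays.

Small error means a small angle to the first axis (`angle_div_pi_le_trainError`). If two consecutive
errors are at most `ε / π`, the iterate turns by at most `2ε`. Elementary trigonometry
(`contraction_of_angle_le`) then bounds the norm ratio by `1 - s` with `s = η * wd - 2ε²`, and
bounds the kick by a multiple of `‖w‖`. So as long as the error stays small the norm decays
geometrically, and after `decayIterations` steps every `batchDescent` must have norm at most `(e/64)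
* √((m-2)/B)`.

By `measure_norm_batchDescent_le` this has probability at most `exp (-1/9)` whatever the nonzero
weight: in directions orthogonal to `w` and to the first axis, each input has a Gaussian component
independent of its label and of its output. Batches are independent of the past, so `9 * log (1/δ)`
further steps bring the probability of persistent small error below `δ`. For the limsup, `δ` tends
to `0` and `ε` increases to its bound. -/

/-! ### The gradient of the normalized loss and the closed form of an SGD step -/

theorem hasFDerivAt_norm_of_ne_zero {V : Type*} [NormedAddCommGroup V] [InnerProductSpace ℝ V]
    {w : V} (hw : w ≠ 0) :
    HasFDerivAt (fun v : V => ‖v‖) (‖w‖⁻¹ • innerSL ℝ w) w := by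
  have h1 : HasFDerivAt (fun v : V => ‖v‖ ^ 2) (2 • innerSL ℝ w) w :=
    (hasStrictFDerivAt_norm_sq w).hasFDerivAt
  have h2 := h1.sqrt (by positivity)
  have h3 : (fun v : V => √(‖v‖ ^ 2)) = fun v => ‖v‖ := by
    ext v; exact Real.sqrt_sq (norm_nonneg v)
  rw [h3, Real.sqrt_sq (norm_nonneg w)] at h2
  convert h2 using 1
  ext v
  have : ‖w‖ ≠ 0 := norm_ne_zero_iff.2 hw
  simp
  field_simp

section

variable {m B : ℕ} [NeZero m]

/-- Minus the norm of `w` times the gradient of the loss at `w` for the input `x`. -/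
noncomputable def scaledDescent (w x : EuclideanSpace ℝ (Fin m)) : EuclideanSpace ℝ (Fin m) :=
  ((1 + Real.exp (inner ℝ x (‖w‖⁻¹ • w) * label x))⁻¹ * label x) •
    (x - (‖w‖⁻¹ ^ 2 * inner ℝ x w) • w)

/-- The average of `scaledDescent` over a batch. -/
noncomputable def batchDescent (w : EuclideanSpace ℝ (Fin m))
    (xs : Fin B → EuclideanSpace ℝ (Fin m)) : EuclideanSpace ℝ (Fin m) :=
  (B : ℝ)⁻¹ • ∑ b, scaledDescent w (xs b)

theorem inner_scaledDescent (w x : EuclideanSpace ℝ (Fin m)) :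
    inner ℝ w (scaledDescent w x) = 0 := by
  rcases eq_or_ne w 0 with rfl | hw
  · simp
  have : ‖w‖ ≠ 0 := norm_ne_zero_iff.2 hw
  have h : inner ℝ w (x - (‖w‖⁻¹ ^ 2 * inner ℝ x w) • w) = 0 := by
    rw [inner_sub_right, real_inner_smul_right, real_inner_self_eq_norm_sq, real_inner_comm]
    field_simp
    ring
  rw [scaledDescent, real_inner_smul_right, h, mul_zero]

theorem inner_batchDescent (w : EuclideanSpace ℝ (Fin m))
    (xs : Fin B → EuclideanSpace ℝ (Fin m)) : inner ℝ w (batchDescent w xs) = 0 := by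
  simp [batchDescent, inner_smul_right, inner_sum, inner_scaledDescent]

theorem hasGradientAt_regularized_bnLoss (wd : ℝ) {w : EuclideanSpace ℝ (Fin m)} (hw : w ≠ 0)
    (x : EuclideanSpace ℝ (Fin m)) :
    HasGradientAt (fun v => bnLoss v x + wd / 2 * ‖v‖ ^ 2)
      (wd • w - ‖w‖⁻¹ • scaledDescent w x) w := by
  have hn : ‖w‖ ≠ 0 := norm_ne_zero_iff.2 hw
  rw [hasGradientAt_iff_hasFDerivAt]
  have h1 := (hasDerivAt_inv hn).comp_hasFDerivAt w (hasFDerivAt_norm_of_ne_zero hw)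
  have h2 := h1.smul (hasFDerivAt_id w)
  have h3 := (hasFDerivAt_const x w).inner ℝ h2
  have h4 := (((h3.mul_const (label x)).neg.exp).const_add 1).log
    (by positivity)
  have h5 := h4.add (((hasStrictFDerivAt_norm_sq w).hasFDerivAt).const_mul (wd / 2))
  refine HasFDerivAt.congr_fderiv h5 ?_
  ext v
  simp only [scaledDescent, inner_sub_left, real_inner_smul_left, real_inner_smul_right,
    InnerProductSpace.toDual_apply_apply, add_apply, smul_apply, innerSL_apply_apply]
  simp [real_inner_smul_right, inner_add_right, smul_eq_mul]
  rw [Real.exp_neg]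
  have he := Real.exp_pos (‖w‖⁻¹ * inner ℝ x w * label x)
  generalize Real.exp (‖w‖⁻¹ * inner ℝ x w * label x) = e at *
  field_simp
  ring

/-- At `w = 0` the right side is `0`. So is the left side: either the default value of `gradient`
applies, or differentiability forces a zero label and only the regularizer varies. Including `0`
makes the step formula, hence its measurability, unconditional. -/
theorem gradient_regularized_bnLoss (wd : ℝ) (w x : EuclideanSpace ℝ (Fin m)) :
    gradient (fun v => bnLoss v x + wd / 2 * ‖v‖ ^ 2) w =
      wd • w - ‖w‖⁻¹ • scaledDescent w x := by
  rcases ne_or_eq w 0 with hw | rfl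
  · exact (hasGradientAt_regularized_bnLoss wd hw x).gradient
  simp only [smul_zero, norm_zero, inv_zero, zero_smul, sub_zero]
  by_cases hd : DifferentiableAt ℝ (fun v => bnLoss v x + wd / 2 * ‖v‖ ^ 2) 0
  swap
  · exact gradient_eq_zero_of_not_differentiableAt hd
  -- Along the ray `s • x` with `s > 0` the loss keeps the value `bnLoss x x`, while at `s = 0` it
  -- is `log 2`; continuity makes these agree, which forces the label to vanish.
  have hl : label x = 0 := by
    have hc : ContinuousAt (fun s : ℝ => bnLoss (s • x) x + wd / 2 * ‖s • x‖ ^ 2) 0 :=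
      ContinuousAt.comp' (f := fun s : ℝ => s • x)
        (g := fun v => bnLoss v x + wd / 2 * ‖v‖ ^ 2)
        (by simpa using hd.continuousAt) (by fun_prop)
    by_contra hl
    have hx : x ≠ 0 := by
      rintro rfl
      simp [label] at hl
    have hx' : ‖x‖ ≠ 0 := norm_ne_zero_iff.2 hx
    have h1 : Tendsto (fun s : ℝ => bnLoss (s • x) x + wd / 2 * ‖s • x‖ ^ 2)
        (nhdsWithin 0 (Set.Ioi 0)) (nhds (Real.log 2)) := by
      have := hc.tendsto.mono_left (nhdsWithin_le_nhds (s := Set.Ioi 0))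
      simpa [bnLoss, logisticLoss, one_add_one_eq_two] using this
    have h2 : Tendsto (fun s : ℝ => bnLoss (s • x) x + wd / 2 * ‖s • x‖ ^ 2)
        (nhdsWithin 0 (Set.Ioi 0)) (nhds (bnLoss x x + wd / 2 * ‖(0 : ℝ) • x‖ ^ 2)) := by
      have h3 : Tendsto (fun s : ℝ => bnLoss x x + wd / 2 * ‖s • x‖ ^ 2)
          (nhdsWithin 0 (Set.Ioi 0)) (nhds (bnLoss x x + wd / 2 * ‖(0 : ℝ) • x‖ ^ 2)) :=
        (Continuous.tendsto (by fun_prop) 0).mono_left nhdsWithin_le_nhds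
      refine h3.congr' ?_
      filter_upwards [self_mem_nhdsWithin] with s hs
      have hs : 0 < s := hs
      have : ‖s • x‖⁻¹ • s • x = ‖x‖⁻¹ • x := by
        rw [norm_smul, smul_smul, Real.norm_of_nonneg hs.le]
        congr 1
        field_simp
      simp [bnLoss, this]
    have h := tendsto_nhds_unique h1 h2
    simp only [zero_smul, norm_zero, bnLoss, logisticLoss] at h
    norm_num at h
    have h3 := Real.log_injOn_pos (by norm_num) (Set.mem_Ioi.2 (by positivity)) h
    have h4 : Real.exp (-(inner ℝ x (‖x‖⁻¹ • x) * label x)) = 1 := by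
      linarith
    rw [Real.exp_eq_one_iff, real_inner_smul_right, real_inner_self_eq_norm_sq] at h4
    have : ‖x‖ * label x = 0 := by
      field_simp at h4
      linarith
    exact (mul_ne_zero hx' hl) this
  have : (fun v => bnLoss v x + wd / 2 * ‖v‖ ^ 2) = fun v => Real.log 2 + wd / 2 * ‖v‖ ^ 2 := by
    ext v
    simp [bnLoss, logisticLoss, hl, one_add_one_eq_two]
  rw [this]
  refine HasGradientAt.gradient ?_
  rw [hasGradientAt_iff_hasFDerivAt]
  have h5 := (((hasStrictFDerivAt_norm_sq (0 : EuclideanSpace ℝ (Fin m))).hasFDerivAt).const_mul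
    (wd / 2)).const_add (Real.log 2)
  refine HasFDerivAt.congr_fderiv h5 ?_
  ext v
  simp

theorem sgdStep_eq (hB : 0 < B) (η wd : ℝ) (w : EuclideanSpace ℝ (Fin m))
    (xs : Fin B → EuclideanSpace ℝ (Fin m)) :
    sgdStep η wd w xs = (1 - η * wd) • w + (η * ‖w‖⁻¹) • batchDescent w xs := by
  have : (B : ℝ) ≠ 0 := by positivity
  simp only [sgdStep, gradient_regularized_bnLoss, batchDescent, Finset.sum_sub_distrib,
    Finset.sum_const, Finset.card_univ, Fintype.card_fin, ← Finset.smul_sum,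
    ← Nat.cast_smul_eq_nsmul ℝ, smul_sub, smul_smul, sub_smul, one_smul]
  have h1 : η / B * (B * wd) = η * wd := by field_simp
  have h2 : η / B * ‖w‖⁻¹ = η * ‖w‖⁻¹ * (B : ℝ)⁻¹ := by ring
  rw [h1, h2]
  abel

theorem measurable_label : Measurable (label (m := m)) := by
  have h : Measurable Real.sign := by
    unfold Real.sign
    exact Measurable.ite measurableSet_Iio measurable_const
      (Measurable.ite measurableSet_Ioi measurable_const measurable_const)
  exact h.comp (by fun_prop)

theorem measurable_batchDescent : Measurable (fun p : EuclideanSpace ℝ (Fin m) ×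
    (Fin B → EuclideanSpace ℝ (Fin m)) => batchDescent p.1 p.2) := by
  have h := measurable_label (m := m)
  unfold batchDescent scaledDescent
  fun_prop

theorem measurable_sgdStep (hB : 0 < B) (η wd : ℝ) : Measurable (fun p : EuclideanSpace ℝ (Fin m) ×
    (Fin B → EuclideanSpace ℝ (Fin m)) => sgdStep η wd p.1 p.2) := by
  simp only [sgdStep_eq hB]
  have := measurable_batchDescent (m := m) (B := B)
  fun_prop

end

/-! ### Standard Gaussian vectors: resampling a component, projections, small-ball bounds -/

section Gaussian

variable {V : Type*} [NormedAddCommGroup V] [InnerProductSpace ℝ V] [FiniteDimensional ℝ V]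
  [MeasurableSpace V] [BorelSpace V]

theorem charFunDual_gaussianReal_standard (L : StrongDual ℝ ℝ) :
    charFunDual (gaussianReal 0 1) L = Complex.exp (-(L 1 : ℂ) ^ 2 / 2) := by
  have h : L = (L 1) • (1 : ℝ →L[ℝ] ℝ) := by
    ext; simp
  have h2 := charFun_gaussianReal (μ := 0) (v := 1) (L 1)
  rw [charFun_apply_real] at h2
  rw [charFunDual_apply]
  simp only [Complex.ofReal_zero, mul_zero, zero_mul, NNReal.coe_one, Complex.ofReal_one,
    one_mul, zero_sub] at h2
  rw [neg_div, ← h2]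
  congr 1
  ext x
  have : L x = L 1 * x := by
    conv_lhs => rw [h]
    simp
  rw [this]
  push_cast
  ring_nf

/-- Replacing the component of a standard Gaussian vector along a unit vector by an independent
standard Gaussian variable gives a standard Gaussian vector. -/
theorem map_resample_stdGaussian {u : V} (hu : ‖u‖ = 1) :
    ((stdGaussian V).prod (gaussianReal 0 1)).map (fun p => p.1 + (p.2 - inner ℝ p.1 u) • u) =
      stdGaussian V := by
  let T : V × ℝ →L[ℝ] V := ContinuousLinearMap.fst ℝ V ℝ +
    (ContinuousLinearMap.snd ℝ V ℝ - (innerSL ℝ u).comp (ContinuousLinearMap.fst ℝ V ℝ)).smulRight u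
  have hT : (fun p : V × ℝ => p.1 + (p.2 - inner ℝ p.1 u) • u) = T := by
    ext p
    simp [T, real_inner_comm]
  rw [hT]
  apply Measure.ext_of_charFunDual
  ext L
  rw [charFunDual_map, charFunDual_prod, charFunDual_stdGaussian, charFunDual_stdGaussian,
    charFunDual_gaussianReal_standard, ← Complex.exp_add]
  congr 1
  obtain ⟨v, rfl⟩ := (InnerProductSpace.toDual ℝ V).surjective L
  have h1 : ((InnerProductSpace.toDual ℝ V v).comp T).comp (ContinuousLinearMap.inl ℝ V ℝ) =
      InnerProductSpace.toDual ℝ V (v - inner ℝ v u • u) := by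
    ext x
    simp [T, real_inner_smul_right]
    ring
  have h2 : ((InnerProductSpace.toDual ℝ V v).comp T).comp (ContinuousLinearMap.inr ℝ V ℝ) 1 =
      inner ℝ v u := by
    simp [T]
  rw [h1, h2, LinearIsometryEquiv.norm_map, LinearIsometryEquiv.norm_map]
  -- By Pythagoras, the exponents contributed by the orthogonal part and by the fresh variable add
  -- up to that of `v`.
  have h3 : ‖v - inner ℝ v u • u‖ ^ 2 = ‖v‖ ^ 2 - (inner ℝ v u) ^ 2 := by
    rw [norm_sub_sq_real, norm_smul, hu, real_inner_smul_right, Real.norm_eq_abs, mul_one, sq_abs]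
    ring
  have h4 : (‖v‖ : ℂ) ^ 2 = (‖v - inner ℝ v u • u‖ : ℂ) ^ 2 + (inner ℝ v u : ℂ) ^ 2 := by
    norm_cast
    linarith
  rw [h4]
  ring

/-- The coordinates of a standard Gaussian vector along two orthogonal unit vectors are independent
standard Gaussian variables. -/
theorem map_inner_prod_stdGaussian {u v : V} (hu : ‖u‖ = 1) (hv : ‖v‖ = 1)
    (huv : inner ℝ u v = 0) :
    (stdGaussian V).map (fun x => ((inner ℝ u x : ℝ), (inner ℝ v x : ℝ))) =
      (gaussianReal 0 1).prod (gaussianReal 0 1) := by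
  let T : V →L[ℝ] ℝ × ℝ := (innerSL ℝ u).prod (innerSL ℝ v)
  have hT : (fun x : V => ((inner ℝ u x : ℝ), (inner ℝ v x : ℝ))) = T := by
    ext p <;> simp [T]
  rw [hT]
  apply Measure.ext_of_charFunDual
  ext L
  rw [charFunDual_map, charFunDual_prod, charFunDual_stdGaussian,
    charFunDual_gaussianReal_standard, charFunDual_gaussianReal_standard, ← Complex.exp_add]
  congr 1
  simp only [ContinuousLinearMap.comp_apply, ContinuousLinearMap.inl_apply,
    ContinuousLinearMap.inr_apply]
  have h1 : L.comp T = InnerProductSpace.toDual ℝ V (L (1, 0) • u + L (0, 1) • v) := by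
    ext x
    have : T x = (inner ℝ u x) • ((1, 0) : ℝ × ℝ) + (inner ℝ v x) • ((0, 1) : ℝ × ℝ) := by
      ext <;> simp [T]
    rw [ContinuousLinearMap.comp_apply, this]
    simp only [map_add, map_smul, smul_eq_mul]
    simp
    ring
  have h3 : ‖L (1, 0) • u + L (0, 1) • v‖ ^ 2 = (L (1, 0)) ^ 2 + (L (0, 1)) ^ 2 := by
    rw [norm_add_sq_real, norm_smul, norm_smul, hu, hv, real_inner_smul_right,
      real_inner_smul_left, huv, Real.norm_eq_abs, Real.norm_eq_abs, mul_one, mul_one, sq_abs,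
      sq_abs]
    ring
  have h4 : (‖L (1, 0) • u + L (0, 1) • v‖ : ℂ) ^ 2 = (L (1, 0) : ℂ) ^ 2 + (L (0, 1) : ℂ) ^ 2 := by
    norm_cast
  rw [h1, LinearIsometryEquiv.norm_map, h4]
  ring

theorem map_inner_stdGaussian (v : V) :
    (stdGaussian V).map (fun x => (inner ℝ v x : ℝ)) = gaussianReal 0 (‖v‖₊ ^ 2) := by
  have h : (fun x : V => (inner ℝ v x : ℝ)) = innerSL ℝ v := by
    ext; simp
  rw [h, IsGaussian.map_eq_gaussianReal, integral_strongDual_stdGaussian,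
    variance_dual_stdGaussian, innerSL_apply_norm]
  congr 1
  ext
  simp

/-- The density is at most `1 / √(2πv) ≤ 1 / (2√v)`, and the interval has length `2r`. -/
theorem gaussianReal_abs_le {v : NNReal} (hv : v ≠ 0) (r : ℝ) :
    gaussianReal 0 v {x | |x| ≤ r} ≤ ENNReal.ofReal (r / √v) := by
  have hs : {x : ℝ | |x| ≤ r} = Set.Icc (-r) r := by
    ext; simp [abs_le]
  rw [hs, gaussianReal_apply _ hv]
  have hv' : 0 < (v : ℝ) := by positivity
  have hb : ∀ x, gaussianPDF 0 v x ≤ ENNReal.ofReal ((2 * √v)⁻¹) := by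
    intro x
    apply ENNReal.ofReal_le_ofReal
    rw [gaussianPDFReal]
    have h1 : Real.exp (-(x - 0) ^ 2 / (2 * v)) ≤ 1 := by
      rw [Real.exp_le_one_iff, neg_div]
      exact neg_nonpos.2 (by positivity)
    have h2 : 2 * √v ≤ √(2 * Real.pi * v) := by
      apply Real.le_sqrt_of_sq_le
      rw [mul_pow, Real.sq_sqrt hv'.le]
      nlinarith [Real.pi_gt_three]
    calc _ ≤ (√(2 * Real.pi * v))⁻¹ * 1 := by gcongr
      _ ≤ _ := by
        rw [mul_one]
        gcongr
  calc _ ≤ ∫⁻ _ in Set.Icc (-r) r, ENNReal.ofReal ((2 * √v)⁻¹) := lintegral_mono hb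
    _ = ENNReal.ofReal (r / √v) := by
      rw [setLIntegral_const, Real.volume_Icc, ← ENNReal.ofReal_mul (by positivity)]
      congr 1
      field_simp
      ring

theorem pi_gaussianReal_abs_sum_le {ι : Type*} [Fintype ι] {c : ι → ℝ} (hc : 0 < ∑ i, c i ^ 2)
    (r : ℝ) :
    Measure.pi (fun _ : ι => gaussianReal 0 1) {ξ | |∑ i, c i * ξ i| ≤ r} ≤
      ENNReal.ofReal (r / √(∑ i, c i ^ 2)) := by
  have hn : ((‖WithLp.toLp 2 c‖₊ ^ 2 : NNReal) : ℝ) = ∑ i, c i ^ 2 := by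
    push_cast
    rw [EuclideanSpace.real_norm_sq_eq]
  have h := gaussianReal_abs_le (v := ‖WithLp.toLp 2 c‖₊ ^ 2) (by
    intro h0
    rw [h0] at hn
    simp at hn
    linarith) r
  rw [← map_inner_stdGaussian, hn, ← map_pi_eq_stdGaussian,
    Measure.map_map (by fun_prop) (by fun_prop), Measure.map_apply (by fun_prop)] at h
  · convert h using 3
    ext ξ
    simp [PiLp.inner_apply, mul_comm]
  · exact measurableSet_le (by fun_prop) (by fun_prop)

end Gaussian

/-! ### The Gaussian measure of a wedge, in polar coordinates -/

theorem lintegral_mul_exp_neg_sq_div_two :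
    ∫⁻ r in Set.Ioi (0 : ℝ), ENNReal.ofReal (r * Real.exp (-r ^ 2 / 2)) = 1 := by
  have hd : ∀ x ∈ Set.Ici (0 : ℝ), HasDerivAt (fun r : ℝ => -Real.exp (-r ^ 2 / 2))
      (x * Real.exp (-x ^ 2 / 2)) x := by
    intro x _
    have := (((hasDerivAt_pow 2 x).fun_neg.div_const 2).exp).fun_neg
    refine this.congr_deriv ?_
    simp
    ring
  have ht : Tendsto (fun r : ℝ => -Real.exp (-r ^ 2 / 2)) atTop (nhds 0) := by
    rw [← neg_zero]
    refine (Real.tendsto_exp_atBot.comp ?_).neg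
    have h1 : Tendsto (fun r : ℝ => r ^ 2 / 2) atTop atTop :=
      (tendsto_pow_atTop two_ne_zero).atTop_div_const (by norm_num)
    refine (tendsto_neg_atTop_atBot.comp h1).congr fun r => ?_
    simp [neg_div]
  have hpos : ∀ x ∈ Set.Ioi (0 : ℝ), 0 ≤ x * Real.exp (-x ^ 2 / 2) := fun x hx =>
    mul_nonneg (le_of_lt hx) (Real.exp_pos _).le
  have hi := integrableOn_Ioi_deriv_of_nonneg' hd hpos ht
  have hv := integral_Ioi_of_hasDerivAt_of_tendsto' hd hi ht
  rw [← ofReal_integral_eq_lintegral_ofReal hi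
    ((ae_restrict_iff' measurableSet_Ioi).2 (Eventually.of_forall hpos)), hv]
  simp

theorem measurableSet_gaussian_wedge (θ : ℝ) : MeasurableSet
    {p : ℝ × ℝ | 0 < p.1 ∧ Real.cos θ * p.1 + Real.sin θ * p.2 < 0} := by
  have h1 : MeasurableSet {p : ℝ × ℝ | 0 < p.1} := measurableSet_lt (by fun_prop) (by fun_prop)
  have h2 : MeasurableSet {p : ℝ × ℝ | Real.cos θ * p.1 + Real.sin θ * p.2 < 0} :=
    measurableSet_lt (by fun_prop) (by fun_prop)
  exact h1.inter h2

/-- The standard Gaussian measure of a planar wedge is at least its angle divided by `2π`. -/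
theorem gaussian_wedge_ge {θ : ℝ} (hpi : θ ≤ Real.pi) :
    ENNReal.ofReal (θ / (2 * Real.pi)) ≤
      ((gaussianReal 0 1).prod (gaussianReal 0 1))
        {p | 0 < p.1 ∧ Real.cos θ * p.1 + Real.sin θ * p.2 < 0} := by
  set S : Set (ℝ × ℝ) := {p | 0 < p.1 ∧ Real.cos θ * p.1 + Real.sin θ * p.2 < 0} with hS
  have hSm : MeasurableSet S := measurableSet_gaussian_wedge θ
  rw [gaussianReal_of_var_ne_zero _ one_ne_zero, prod_withDensity (measurable_gaussianPDF _ _)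
      (measurable_gaussianPDF _ _), withDensity_apply _ hSm, ← lintegral_indicator hSm, ← Measure.volume_eq_prod,
    ← lintegral_comp_polarCoord_symm]
  -- On this range of angles `φ` both `cos φ > 0` and `cos (θ - φ) < 0`, so the sector lies in the
  -- wedge; this inclusion suffices for a lower bound.
  have hsub : Set.Ioi (0 : ℝ) ×ˢ Set.Ioo (-(Real.pi / 2)) (θ - Real.pi / 2) ⊆ polarCoord.target := by
    rintro ⟨r, φ⟩ ⟨hr, hφ⟩
    have := Real.pi_pos
    refine ⟨hr, ?_, ?_⟩
    · linarith [hφ.1]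
    · linarith [hφ.2]
  have hval : ∀ p ∈ Set.Ioi (0 : ℝ) ×ˢ Set.Ioo (-(Real.pi / 2)) (θ - Real.pi / 2),
      ENNReal.ofReal (p.1 * Real.exp (-p.1 ^ 2 / 2)) * ENNReal.ofReal ((2 * Real.pi)⁻¹) ≤
      ENNReal.ofReal p.1 • S.indicator (fun z => gaussianPDF 0 1 z.1 * gaussianPDF 0 1 z.2)
        (polarCoord.symm p) := by
    rintro ⟨r, φ⟩ ⟨hr, hφ1, hφ2⟩
    simp only [Set.mem_Ioi] at hr hφ1 hφ2
    have hmem : polarCoord.symm (r, φ) ∈ S := by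
      rw [hS, polarCoord_symm_apply]
      constructor
      · exact mul_pos hr (Real.cos_pos_of_mem_Ioo ⟨hφ1, by linarith⟩)
      · have h1 : Real.cos (θ - φ) < 0 :=
          Real.cos_neg_of_pi_div_two_lt_of_lt (by linarith) (by linarith)
        rw [Real.cos_sub] at h1
        nlinarith
    rw [Set.indicator_of_mem hmem, polarCoord_symm_apply, smul_eq_mul, gaussianPDF, gaussianPDF,
      ← ENNReal.ofReal_mul (gaussianPDFReal_nonneg _ _ _), ← ENNReal.ofReal_mul hr.le,
      ← ENNReal.ofReal_mul (mul_nonneg hr.le (Real.exp_pos _).le)]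
    apply ENNReal.ofReal_le_ofReal
    rw [gaussianPDFReal, gaussianPDFReal]
    simp only [NNReal.coe_one, mul_one, sub_zero]
    have h2 : √(2 * Real.pi) * √(2 * Real.pi) = 2 * Real.pi :=
      Real.mul_self_sqrt (by positivity)
    have h3 : (√(2 * Real.pi))⁻¹ * Real.exp (-(r * Real.cos φ) ^ 2 / 2) *
        ((√(2 * Real.pi))⁻¹ * Real.exp (-(r * Real.sin φ) ^ 2 / 2)) =
        (√(2 * Real.pi) * √(2 * Real.pi))⁻¹ *
          (Real.exp (-(r * Real.cos φ) ^ 2 / 2) * Real.exp (-(r * Real.sin φ) ^ 2 / 2)) := by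
      rw [mul_inv]
      ring
    have h4 : -(r * Real.cos φ) ^ 2 / 2 + -(r * Real.sin φ) ^ 2 / 2 = -r ^ 2 / 2 := by
      nlinarith [Real.sin_sq_add_cos_sq φ]
    rw [h3, h2, ← Real.exp_add, h4]
    exact le_of_eq (by ring)
  calc ENNReal.ofReal (θ / (2 * Real.pi))
      = ∫⁻ p in Set.Ioi (0 : ℝ) ×ˢ Set.Ioo (-(Real.pi / 2)) (θ - Real.pi / 2),
        ENNReal.ofReal (p.1 * Real.exp (-p.1 ^ 2 / 2)) * ENNReal.ofReal ((2 * Real.pi)⁻¹) := by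
        rw [Measure.volume_eq_prod, ← Measure.prod_restrict,
          lintegral_prod_mul (f := fun r : ℝ => ENNReal.ofReal (r * Real.exp (-r ^ 2 / 2)))
            (g := fun _ : ℝ => ENNReal.ofReal ((2 * Real.pi)⁻¹)) (by fun_prop) (by fun_prop),
          lintegral_mul_exp_neg_sq_div_two, setLIntegral_const, Real.volume_Ioo, one_mul,
          ← ENNReal.ofReal_mul (by positivity)]
        congr 1
        field_simp
        ring
    _ ≤ _ := setLIntegral_mono' (measurableSet_Ioi.prod measurableSet_Ioo) hval
    _ ≤ _ := lintegral_mono_set hsub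

/-! ### The training error controls the angle to the first axis -/

section TrainError

variable {m : ℕ} [NeZero m]

theorem inner_single_zero (x : EuclideanSpace ℝ (Fin m)) :
    inner ℝ (EuclideanSpace.single (0 : Fin m) (1 : ℝ)) x = x 0 := by
  simp [EuclideanSpace.inner_single_left]

theorem trainError_zero : trainError (0 : EuclideanSpace ℝ (Fin m)) = 1 := by
  simp [trainError]

theorem trainError_le_one (w : EuclideanSpace ℝ (Fin m)) : trainError w ≤ 1 :=
  measureReal_le_one

theorem exists_unit_orthogonal {V : Type*} [NormedAddCommGroup V] [InnerProductSpace ℝ V]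
    [FiniteDimensional ℝ V] (hV : 2 ≤ Module.finrank ℝ V) (u : V) :
    ∃ v : V, ‖v‖ = 1 ∧ inner ℝ u v = 0 := by
  have h1 := Submodule.finrank_add_finrank_orthogonal (Submodule.span ℝ {u})
  have h2 : Module.finrank ℝ (Submodule.span ℝ {u}) ≤ 1 := by
    simpa using finrank_span_le_card (R := ℝ) ({u} : Set V)
  have : Nontrivial (Submodule.span ℝ {u})ᗮ :=
    Module.nontrivial_of_finrank_pos (R := ℝ) (by omega)
  obtain ⟨v, hv⟩ := exists_norm_eq (Submodule.span ℝ {u})ᗮ (zero_le_one' ℝ)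
  exact ⟨v, hv, Submodule.mem_orthogonal_singleton_iff_inner_right.1 v.2⟩

/-- `v` is the normalized component of `w` orthogonal to `u`. If that component vanishes, any
orthogonal unit vector serves, which is where dimension at least `2` enters. -/
theorem exists_angle_decomposition {V : Type*} [NormedAddCommGroup V] [InnerProductSpace ℝ V]
    [FiniteDimensional ℝ V] (hV : 2 ≤ Module.finrank ℝ V) {u : V} (hu : ‖u‖ = 1) (w : V) :
    ∃ v : V, ‖v‖ = 1 ∧ inner ℝ u v = 0 ∧
      w = ‖w‖ • (Real.cos (InnerProductGeometry.angle u w) • u +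
        Real.sin (InnerProductGeometry.angle u w) • v) := by
  have hc := InnerProductGeometry.cos_angle_mul_norm_mul_norm u w
  have hs := InnerProductGeometry.sin_angle_nonneg u w
  set θ := InnerProductGeometry.angle u w
  rw [hu, one_mul] at hc
  set p := w - (inner ℝ u w : ℝ) • u with hp
  have hup : inner ℝ u p = 0 := by
    rw [hp, inner_sub_right, real_inner_smul_right, real_inner_self_eq_norm_sq, hu]
    ring
  have hpn : ‖p‖ = Real.sin θ * ‖w‖ := by
    rw [← sq_eq_sq₀ (norm_nonneg _) (by positivity), hp, norm_sub_sq_real, norm_smul, hu,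
      real_inner_smul_right, Real.norm_eq_abs, mul_one, sq_abs, real_inner_comm u w, ← hc]
    linear_combination -‖w‖ ^ 2 * Real.sin_sq_add_cos_sq θ
  obtain ⟨v, hv1, hv2, hv3⟩ : ∃ v : V, ‖v‖ = 1 ∧ inner ℝ u v = 0 ∧ p = ‖p‖ • v := by
    rcases eq_or_ne p 0 with h0 | h0
    · obtain ⟨v, hv, hv'⟩ := exists_unit_orthogonal hV u
      exact ⟨v, hv, hv', by simp [h0]⟩
    · have : ‖p‖ ≠ 0 := norm_ne_zero_iff.2 h0
      refine ⟨‖p‖⁻¹ • p, ?_, ?_, ?_⟩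
      · rw [norm_smul, norm_inv, norm_norm, inv_mul_cancel₀ this]
      · rw [real_inner_smul_right, hup, mul_zero]
      · rw [smul_smul, mul_inv_cancel₀ this, one_smul]
  refine ⟨v, hv1, hv2, ?_⟩
  have : w = p + (inner ℝ u w : ℝ) • u := by rw [hp]; abel
  rw [smul_add, smul_smul, smul_smul, mul_comm ‖w‖, hc, mul_comm ‖w‖, ← hpn, ← hv3, add_comm]
  exact this

/-- The training error of `w ≠ 0` is at least the angle between the first coordinate axis and `w`,
divided by `π`. -/
theorem angle_div_pi_le_trainError (hm : 2 ≤ m) {w : EuclideanSpace ℝ (Fin m)} (hw : w ≠ 0) :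
    InnerProductGeometry.angle (EuclideanSpace.single (0 : Fin m) (1 : ℝ)) w / Real.pi ≤
      trainError w := by
  set u : EuclideanSpace ℝ (Fin m) := EuclideanSpace.single (0 : Fin m) (1 : ℝ) with hu'
  have hu : ‖u‖ = 1 := by simp [hu']
  have hwn : 0 < ‖w‖ := norm_pos_iff.2 hw
  obtain ⟨v, hv, huv, hwv⟩ := exists_angle_decomposition (by simpa using hm) hu w
  have h0 := InnerProductGeometry.angle_nonneg u w
  have hpi := InnerProductGeometry.angle_le_pi u w
  set θ := InnerProductGeometry.angle u w
  have hx0 (x : EuclideanSpace ℝ (Fin m)) : inner ℝ u x = x 0 := inner_single_zero x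
  have hxw (x : EuclideanSpace ℝ (Fin m)) : (inner ℝ x w : ℝ) =
      ‖w‖ * (Real.cos θ * inner ℝ u x + Real.sin θ * inner ℝ v x) := by
    conv_lhs => rw [hwv]
    rw [real_inner_smul_right, inner_add_right, real_inner_smul_right, real_inner_smul_right,
      real_inner_comm, real_inner_comm v]
  set W : Set (EuclideanSpace ℝ (Fin m)) := {x | 0 < x 0 ∧ inner ℝ x w < 0} with hW
  have hWm : MeasurableSet W := by
    have h1 : MeasurableSet {x : EuclideanSpace ℝ (Fin m) | 0 < x 0} :=
      measurableSet_lt (by fun_prop) (by fun_prop)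
    have h2 : MeasurableSet {x : EuclideanSpace ℝ (Fin m) | inner ℝ x w < 0} :=
      measurableSet_lt (by fun_prop) (by fun_prop)
    exact h1.inter h2
  have hγ : ENNReal.ofReal (θ / (2 * Real.pi)) ≤ stdGaussian (EuclideanSpace ℝ (Fin m)) W := by
    refine (gaussian_wedge_ge hpi).trans_eq ?_
    rw [← map_inner_prod_stdGaussian hu hv huv, Measure.map_apply (by fun_prop)
      (measurableSet_gaussian_wedge θ)]
    congr 1
    ext x
    simp only [Set.mem_preimage, Set.mem_ofPred_eq, hW, hxw, hx0]
    refine and_congr_right fun _ => ⟨fun h => mul_neg_of_pos_of_neg hwn h, fun h => ?_⟩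
    exact neg_of_mul_neg_right h hwn.le
  -- Misclassified inputs come in two opposite wedges of equal measure, which turns `θ / (2π)` into
  -- `θ / π`.
  have hneg : stdGaussian (EuclideanSpace ℝ (Fin m)) ((fun x => -x) ⁻¹' W) =
      stdGaussian (EuclideanSpace ℝ (Fin m)) W := by
    rw [← Measure.map_apply measurable_neg hWm]
    congr 1
    exact stdGaussian_map (LinearIsometryEquiv.neg ℝ)
  have hdisj : Disjoint W ((fun x => -x) ⁻¹' W) := by
    rw [Set.disjoint_left]
    rintro x ⟨h1, _⟩ ⟨h2, _⟩
    simp at h2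
    linarith
  have hsub : W ∪ (fun x => -x) ⁻¹' W ⊆ {x | inner ℝ x w * label x ≤ 0} := by
    rintro x (⟨h1, h2⟩ | ⟨h1, h2⟩)
    · simp only [Set.mem_ofPred_eq, label, Real.sign_of_pos h1]
      linarith
    · simp only [PiLp.neg_apply, inner_neg_left] at h1 h2
      simp only [Set.mem_ofPred_eq, label, Real.sign_of_neg (neg_pos.1 h1)]
      linarith
  have hfin := measure_mono (μ := stdGaussian (EuclideanSpace ℝ (Fin m))) hsub
  rw [measure_union hdisj (measurable_neg hWm), hneg] at hfin
  have h3 := (add_le_add hγ hγ).trans hfin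
  rw [← ENNReal.ofReal_add (by positivity) (by positivity)] at h3
  have h4 := (ENNReal.ofReal_le_iff_le_toReal (measure_ne_top _ _)).1 h3
  refine le_trans (le_of_eq ?_) h4
  field_simp
  ring

end TrainError

/-! ### Contraction of the norm when the iterate turns little -/

/-- A right triangle: with `θ` the angle between `w` and `w'`, `cos θ * ‖w'‖ = (1 - a) * ‖w‖` and
`sin θ * ‖w'‖ = ‖g‖`. Now use `cos θ ≥ 1 - 2ε²` and `sin θ ≤ 2ε`. -/
theorem contraction_of_angle_le {V : Type*} [NormedAddCommGroup V] [InnerProductSpace ℝ V]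
    {w g w' : V} {a ε : ℝ} (hw : w ≠ 0) (hw' : w' ≠ 0) (hg : inner ℝ w g = 0)
    (hstep : w' = (1 - a) • w + g) (hε : ε ≤ Real.pi / 4) (ha : 2 * ε ^ 2 < a)
    (hangle : InnerProductGeometry.angle w w' ≤ 2 * ε) :
    a < 1 ∧ ‖w'‖ ≤ (1 - (a - 2 * ε ^ 2)) * ‖w‖ ∧
      ‖g‖ ≤ 2 * ε * ((1 - (a - 2 * ε ^ 2)) * ‖w‖) := by
  have hn : 0 < ‖w‖ := norm_pos_iff.2 hw
  have hn' : 0 < ‖w'‖ := norm_pos_iff.2 hw'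
  have hcos := InnerProductGeometry.cos_angle_mul_norm_mul_norm w w'
  have h0 := InnerProductGeometry.angle_nonneg w w'
  have hsin0 := InnerProductGeometry.sin_angle_nonneg w w'
  set θ := InnerProductGeometry.angle w w'
  have hc1 : Real.cos θ * ‖w'‖ = (1 - a) * ‖w‖ := by
    rw [hstep, inner_add_right, hg, real_inner_smul_right, real_inner_self_eq_norm_sq, ← hstep]
      at hcos
    apply mul_left_cancel₀ hn.ne'
    linarith
  have hnorm : ‖w'‖ ^ 2 = ((1 - a) * ‖w‖) ^ 2 + ‖g‖ ^ 2 := by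
    rw [hstep, norm_add_sq_real, real_inner_smul_left, hg, norm_smul, mul_pow, mul_pow,
      Real.norm_eq_abs, sq_abs]
    ring
  have hgs : ‖g‖ = Real.sin θ * ‖w'‖ := by
    rw [← sq_eq_sq₀ (norm_nonneg _) (by positivity)]
    rw [← hc1] at hnorm
    linear_combination -hnorm - ‖w'‖ ^ 2 * Real.sin_sq_add_cos_sq θ
  have hcq : 1 - 2 * ε ^ 2 ≤ Real.cos θ := by
    have := Real.one_sub_sq_div_two_le_cos (x := θ)
    nlinarith
  have hc0 : 0 ≤ Real.cos θ :=
    Real.cos_nonneg_of_mem_Icc ⟨by linarith [Real.pi_pos], by linarith⟩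
  -- If `a ≥ 1`, the two sides of `hc1` have opposite signs, so `cos θ = 0` and `a = 1`; but then
  -- `cos θ ≥ 1 - 2ε² > 1 - a = 0`.
  have ha1 : a < 1 := by
    by_contra! h
    have h1 : 0 ≤ Real.cos θ * ‖w'‖ := by positivity
    have h2 : (1 - a) * ‖w‖ ≤ 0 := mul_nonpos_of_nonpos_of_nonneg (by linarith) hn.le
    have h3 : Real.cos θ = 0 := by
      have : Real.cos θ * ‖w'‖ = 0 := by linarith
      simpa [hn'.ne'] using this
    rw [h3] at hc1
    have h4 : a = 1 := by
      have : 1 - a = 0 := by simpa [hn.ne'] using hc1.symm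
      linarith
    linarith
  have hq : 0 < 1 - 2 * ε ^ 2 := by linarith
  have hw'le : ‖w'‖ ≤ (1 - (a - 2 * ε ^ 2)) * ‖w‖ := by
    have h1 : (1 - 2 * ε ^ 2) * ‖w'‖ ≤ (1 - a) * ‖w‖ := by
      rw [← hc1]
      gcongr
    -- The difference of the two sides is `2ε² * (a - 2ε²)`.
    have h2 : 1 - a ≤ (1 - 2 * ε ^ 2) * (1 - (a - 2 * ε ^ 2)) := by nlinarith [sq_nonneg ε]
    have h3 : (1 - a) * ‖w‖ ≤ (1 - 2 * ε ^ 2) * (1 - (a - 2 * ε ^ 2)) * ‖w‖ := by gcongr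
    refine le_of_mul_le_mul_left ?_ hq
    linarith
  refine ⟨ha1, hw'le, ?_⟩
  rw [hgs]
  have : Real.sin θ ≤ 2 * ε := (Real.sin_le h0).trans hangle
  exact mul_le_mul this hw'le hn'.le (h0.trans hangle)

section

variable {m B : ℕ} [NeZero m]

/-- If two consecutive iterates both have small training error, then the norm contracts and the
stochastic part of the update is small. -/
theorem sgdStep_of_trainError_le (hm : 2 ≤ m) (hB : 0 < B) {η wd ε : ℝ} (hη : 0 < η)
    (hε : ε ≤ Real.pi / 4) (hwd : 2 * ε ^ 2 < η * wd)
    {w : EuclideanSpace ℝ (Fin m)} {xs : Fin B → EuclideanSpace ℝ (Fin m)}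
    (hw : w ≠ 0) (hw' : sgdStep η wd w xs ≠ 0) (h : trainError w ≤ ε / Real.pi)
    (h' : trainError (sgdStep η wd w xs) ≤ ε / Real.pi) :
    η * wd < 1 ∧ ‖sgdStep η wd w xs‖ ≤ (1 - (η * wd - 2 * ε ^ 2)) * ‖w‖ ∧
      η * ‖batchDescent w xs‖ ≤ 2 * ε * (1 - (η * wd - 2 * ε ^ 2)) * ‖w‖ ^ 2 := by
  have hπ := Real.pi_pos
  have hn : 0 < ‖w‖ := norm_pos_iff.2 hw
  have h1 := (angle_div_pi_le_trainError hm hw).trans h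
  have h2 := (angle_div_pi_le_trainError hm hw').trans h'
  rw [div_le_div_iff_of_pos_right hπ] at h1 h2
  rw [InnerProductGeometry.angle_comm] at h1
  -- Both iterates are within `ε` of the first axis, hence within `2ε` of each other.
  have h3 := InnerProductGeometry.angle_le_angle_add_angle w
    (EuclideanSpace.single (0 : Fin m) (1 : ℝ)) (sgdStep η wd w xs)
  obtain ⟨ha, hb, hc⟩ := contraction_of_angle_le hw hw'
    (by rw [real_inner_smul_right, inner_batchDescent, mul_zero])
    (sgdStep_eq hB η wd w xs) hε hwd (by linarith)
  refine ⟨ha, hb, ?_⟩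
  rw [norm_smul, Real.norm_of_nonneg (by positivity)] at hc
  calc η * ‖batchDescent w xs‖ = ‖w‖ * (η * ‖w‖⁻¹ * ‖batchDescent w xs‖) := by field_simp
    _ ≤ ‖w‖ * (2 * ε * ((1 - (η * wd - 2 * ε ^ 2)) * ‖w‖)) := by gcongr
    _ = _ := by ring

theorem ne_zero_of_trainError_le {w : EuclideanSpace ℝ (Fin m)} {ε : ℝ} (hε : ε ≤ Real.pi / 4)
    (h : trainError w ≤ ε / Real.pi) : w ≠ 0 := by
  rintro rfl
  rw [trainError_zero, le_div_iff₀ Real.pi_pos] at h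
  linarith [Real.pi_pos]

/-! ### Anti-concentration of the stochastic part of the update -/

theorem ae_label_ne_zero : ∀ᵐ x ∂(stdGaussian (EuclideanSpace ℝ (Fin m))), label x ≠ 0 := by
  have h1 : (stdGaussian (EuclideanSpace ℝ (Fin m))) {x | x 0 = 0} = 0 := by
    have h2 : {x : EuclideanSpace ℝ (Fin m) | x 0 = 0} =
        (fun x => inner ℝ (EuclideanSpace.single (0 : Fin m) (1 : ℝ)) x) ⁻¹' {0} := by
      ext x
      simp [inner_single_zero]
    rw [h2, ← Measure.map_apply (by fun_prop) (measurableSet_singleton 0), map_inner_stdGaussian]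
    have : NullSingletonClass (gaussianReal 0 (‖EuclideanSpace.single (0 : Fin m) (1 : ℝ)‖₊ ^ 2)) :=
      nullSingletonClass_gaussianReal (by simp)
    exact measure_singleton 0
  rw [ae_iff]
  refine measure_mono_null (fun x hx => ?_) h1
  simpa [label, Real.sign_eq_zero_iff] using hx

theorem label_sq_eq_one {x : EuclideanSpace ℝ (Fin m)} (h : label x ≠ 0) : label x ^ 2 = 1 := by
  unfold label at *
  rcases Real.sign_apply_eq_of_ne_zero (x 0) (fun h0 => h (by simp [h0])) with h1 | h1 <;>
    simp [h1]

theorem exp_half_le_two : Real.exp (1 / 2) ≤ 2 := by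
  have h1 : Real.exp (1 / 2) ^ 2 = Real.exp 1 := by
    rw [← Real.exp_nat_mul]
    norm_num
  have := Real.exp_one_lt_d9
  nlinarith [Real.exp_pos (1 / 2)]

/-- The integral is `1 + 2 * exp (1/2)` by the Gaussian moment generating function. The integrand
dominates the inverse logistic weight for either label. -/
theorem lintegral_one_add_exp_le {V : Type*} [NormedAddCommGroup V] [InnerProductSpace ℝ V]
    [FiniteDimensional ℝ V] [MeasurableSpace V] [BorelSpace V] {v : V} (hv : ‖v‖ = 1) :
    ∫⁻ x, ENNReal.ofReal (1 + Real.exp (inner ℝ v x) + Real.exp (-inner ℝ v x)) ∂stdGaussian V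
      ≤ 5 := by
  have hv' : ‖v‖₊ = 1 := by
    ext
    simpa using hv
  have h := map_inner_stdGaussian v
  rw [hv', one_pow] at h
  have he : ∀ t : ℝ, ∫⁻ z, ENNReal.ofReal (Real.exp (t * z)) ∂gaussianReal 0 1 =
      ENNReal.ofReal (Real.exp (t ^ 2 / 2)) := by
    intro t
    rw [← ofReal_integral_eq_lintegral_ofReal (integrable_exp_mul_gaussianReal t)
      (Eventually.of_forall fun _ => (Real.exp_pos _).le)]
    have := congrFun (mgf_fun_id_gaussianReal (μ := 0) (v := 1)) t
    rw [mgf] at this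
    rw [this]
    simp
  calc _ = ∫⁻ z, ENNReal.ofReal (1 + Real.exp z + Real.exp (-z)) ∂gaussianReal 0 1 := by
        rw [← h, lintegral_map (by fun_prop) (by fun_prop)]
    _ = ∫⁻ z, (1 + ENNReal.ofReal (Real.exp (1 * z)) + ENNReal.ofReal (Real.exp (-1 * z)))
          ∂gaussianReal 0 1 := by
        congr 1
        ext z
        rw [ENNReal.ofReal_add (by positivity) (by positivity),
          ENNReal.ofReal_add (by positivity) (by positivity), ENNReal.ofReal_one, one_mul,
          neg_one_mul]
    _ = 1 + ENNReal.ofReal (Real.exp (1 / 2)) + ENNReal.ofReal (Real.exp (1 / 2)) := by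
        rw [lintegral_add_left (by fun_prop), lintegral_add_left (by fun_prop), he, he]
        simp
    _ ≤ 1 + ENNReal.ofReal 2 + ENNReal.ofReal 2 := by
        gcongr <;> exact exp_half_le_two
    _ = 5 := by norm_num

/-- The weight of the input `x` in `scaledDescent w x`. -/
noncomputable def descentWeight (w x : EuclideanSpace ℝ (Fin m)) : ℝ :=
  (1 + Real.exp (inner ℝ x (‖w‖⁻¹ • w) * label x))⁻¹ * label x

theorem inner_batchDescent_of_orthogonal {w u : EuclideanSpace ℝ (Fin m)} (huw : inner ℝ w u = 0)
    (xs : Fin B → EuclideanSpace ℝ (Fin m)) :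
    inner ℝ (batchDescent w xs) u = (B : ℝ)⁻¹ * ∑ b, descentWeight w (xs b) * inner ℝ (xs b) u := by
  simp only [batchDescent, scaledDescent, descentWeight, real_inner_smul_left, sum_inner,
    inner_sub_left, huw, mul_zero, sub_zero]

/-- The inequality between quadratic, arithmetic and harmonic means, inverted. It replaces the
standard deviation of a whole batch by a sum over single inputs, which integrates term by term with
no loss in `B`. -/
theorem sqrt_card_div_le {ι : Type*} [Fintype ι] [Nonempty ι] {σ : ι → ℝ} (hσ : ∀ i, 0 < σ i) :
    √(Fintype.card ι : ℝ) / √(∑ i, σ i ^ 2) ≤ (Fintype.card ι : ℝ)⁻¹ * ∑ i, (σ i)⁻¹ := by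
  set n : ℝ := (Fintype.card ι : ℝ) with hn
  have hn0 : 0 < n := by simp [hn, Fintype.card_pos]
  have hS : 0 < ∑ i, σ i := Finset.sum_pos (fun i _ => hσ i) Finset.univ_nonempty
  have h1 : (∑ i, σ i) ^ 2 ≤ n * ∑ i, σ i ^ 2 := by
    simpa [hn] using sq_sum_le_card_mul_sum_sq (s := Finset.univ) (f := σ)
  have h2 : n ^ 2 ≤ (∑ i, σ i) * ∑ i, (σ i)⁻¹ := by
    have := Finset.sum_sq_le_sum_mul_sum_of_sq_le_mul Finset.univ (r := fun _ => (1 : ℝ)) (f := σ)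
      (g := fun i => (σ i)⁻¹) (fun i _ => (hσ i).le) (fun i _ => (inv_pos.2 (hσ i)).le)
      (fun i _ => by simp [mul_inv_cancel₀ (hσ i).ne'])
    simpa [hn] using this
  have h3 : (∑ i, σ i) / √n ≤ √(∑ i, σ i ^ 2) := by
    apply Real.le_sqrt_of_sq_le
    rw [div_pow, Real.sq_sqrt hn0.le, div_le_iff₀ hn0]
    linarith
  calc √n / √(∑ i, σ i ^ 2) ≤ √n / ((∑ i, σ i) / √n) := by
        gcongr
    _ = n / ∑ i, σ i := by
        rw [div_div_eq_mul_div, Real.mul_self_sqrt hn0.le]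
    _ ≤ n⁻¹ * ∑ i, (σ i)⁻¹ := by
        rw [div_le_iff₀ hS, mul_assoc, ← div_eq_inv_mul, le_div_iff₀ hn0]
        linarith

end

section

variable {m B : ℕ}

theorem map_pi_resample_stdGaussian {u : EuclideanSpace ℝ (Fin m)} (hu : ‖u‖ = 1) :
    MeasurePreserving (fun (p : (Fin B → EuclideanSpace ℝ (Fin m)) × (Fin B → ℝ)) (b : Fin B) =>
        p.1 b + (p.2 b - inner ℝ (p.1 b) u) • u)
      ((Measure.pi fun _ => stdGaussian (EuclideanSpace ℝ (Fin m))).prod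
        (Measure.pi fun _ => gaussianReal 0 1))
      (Measure.pi fun _ => stdGaussian (EuclideanSpace ℝ (Fin m))) := by
  have h1 : MeasurePreserving
      (fun p : EuclideanSpace ℝ (Fin m) × ℝ => p.1 + (p.2 - inner ℝ p.1 u) • u)
      ((stdGaussian (EuclideanSpace ℝ (Fin m))).prod (gaussianReal 0 1))
      (stdGaussian (EuclideanSpace ℝ (Fin m))) :=
    ⟨by fun_prop, map_resample_stdGaussian hu⟩
  have h2 := measurePreserving_pi (ι := Fin B) _ _ (fun _ => h1)
  have h3 := (measurePreserving_arrowProdEquivProdArrow (EuclideanSpace ℝ (Fin m)) ℝ (Fin B)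
    (fun _ => stdGaussian (EuclideanSpace ℝ (Fin m))) (fun _ => gaussianReal 0 1)).symm
  exact h2.comp h3

variable [NeZero m]

/-- The weight sees the input only through its first coordinate and its inner product with `w`, so a
component along `u` can be resampled without affecting it. -/
theorem descentWeight_resample {w u : EuclideanSpace ℝ (Fin m)} (huw : inner ℝ w u = 0)
    (hu0 : u 0 = 0) (x : EuclideanSpace ℝ (Fin m)) (s : ℝ) :
    descentWeight w (x + s • u) = descentWeight w x := by
  have h1 : label (x + s • u) = label x := by
    simp [label, hu0]
  rw [descentWeight, descentWeight, h1, real_inner_smul_right, real_inner_smul_right,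
    inner_add_left, real_inner_smul_left, real_inner_comm w u, huw, mul_zero, add_zero]

theorem inv_abs_descentWeight_le (w x : EuclideanSpace ℝ (Fin m)) (h : label x ≠ 0) :
    0 < |descentWeight w x| ∧ |descentWeight w x|⁻¹ ≤
      1 + Real.exp (inner ℝ (‖w‖⁻¹ • w) x) + Real.exp (-inner ℝ (‖w‖⁻¹ • w) x) := by
  have habs : |label x| = 1 := by
    rw [← sq_eq_sq₀ (abs_nonneg _) zero_le_one, sq_abs, label_sq_eq_one h, one_pow]
  rw [descentWeight, abs_mul, habs, mul_one, real_inner_comm, abs_of_pos (by positivity), inv_inv]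
  refine ⟨by positivity, ?_⟩
  rcases eq_or_eq_neg_of_abs_eq habs with h1 | h1 <;> rw [h1]
  · rw [mul_one]
    linarith [Real.exp_pos (-inner ℝ (‖w‖⁻¹ • w) x)]
  · rw [mul_neg_one]
    linarith [Real.exp_pos (inner ℝ (‖w‖⁻¹ • w) x)]

/-- With `z` frozen, the inner product is the linear combination of the fresh Gaussians `ξ b` with
the fixed coefficients `descentWeight w (z b) / B`, so the one-dimensional small-ball bound applies.
-/
theorem pi_gaussianReal_abs_inner_batchDescent_le (hB : 0 < B) {w u : EuclideanSpace ℝ (Fin m)}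
    (hu : ‖u‖ = 1) (huw : inner ℝ w u = 0) (hu0 : u 0 = 0) {r : ℝ} (hr : 0 ≤ r)
    {z : Fin B → EuclideanSpace ℝ (Fin m)} (hz : ∀ b, label (z b) ≠ 0) :
    (Measure.pi fun _ : Fin B => gaussianReal 0 1)
      {ξ | |inner ℝ (batchDescent w fun b => z b + (ξ b - inner ℝ (z b) u) • u) u| ≤
        r / √(B : ℝ)} ≤
      ENNReal.ofReal (r * ((B : ℝ)⁻¹ * ∑ b, (1 + Real.exp (inner ℝ (‖w‖⁻¹ • w) (z b)) +
        Real.exp (-inner ℝ (‖w‖⁻¹ • w) (z b))))) := by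
  have : Nonempty (Fin B) := ⟨⟨0, hB⟩⟩
  have hB' : (0 : ℝ) < B := by exact_mod_cast hB
  have hσ : ∀ b, 0 < |descentWeight w (z b)| := fun b => (inv_abs_descentWeight_le w _ (hz b)).1
  have hsq : ∑ b, |descentWeight w (z b)| ^ 2 = ∑ b, descentWeight w (z b) ^ 2 := by
    simp only [sq_abs]
  have hpos : 0 < ∑ b, descentWeight w (z b) ^ 2 := by
    rw [← hsq]
    exact Finset.sum_pos (fun b _ => pow_pos (hσ b) 2) Finset.univ_nonempty
  have hset : {ξ : Fin B → ℝ | |inner ℝ (batchDescent w fun b =>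
        z b + (ξ b - inner ℝ (z b) u) • u) u| ≤ r / √(B : ℝ)} =
      {ξ : Fin B → ℝ | |∑ b, descentWeight w (z b) * ξ b| ≤ √B * r} := by
    ext ξ
    have hr' : (B : ℝ) * (r / √B) = √B * r := by
      rw [mul_div_left_comm, Real.div_sqrt, mul_comm]
    simp only [Set.mem_ofPred_eq, inner_batchDescent_of_orthogonal huw,
      descentWeight_resample huw hu0, inner_add_left, real_inner_smul_left,
      real_inner_self_eq_norm_sq, hu, one_pow, mul_one, add_sub_cancel]
    rw [abs_mul, abs_of_pos (inv_pos.2 hB'), inv_mul_le_iff₀ hB', hr']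
  rw [hset]
  refine (pi_gaussianReal_abs_sum_le hpos _).trans (ENNReal.ofReal_le_ofReal ?_)
  have h1 := sqrt_card_div_le hσ
  rw [Fintype.card_fin, hsq] at h1
  rw [mul_comm (√(B : ℝ)) r, mul_div_assoc]
  refine mul_le_mul_of_nonneg_left (h1.trans ?_) hr
  refine mul_le_mul_of_nonneg_left ?_ (inv_pos.2 hB').le
  exact Finset.sum_le_sum fun b _ => (inv_abs_descentWeight_le w _ (hz b)).2

/-- A single coordinate of the stochastic part of the update is rarely small. -/
theorem measure_abs_inner_batchDescent_le (hB : 0 < B) {w u : EuclideanSpace ℝ (Fin m)}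
    (hw : w ≠ 0) (hu : ‖u‖ = 1) (huw : inner ℝ w u = 0) (hu0 : u 0 = 0) {r : ℝ} (hr : 0 ≤ r) :
    (Measure.pi fun _ : Fin B => stdGaussian (EuclideanSpace ℝ (Fin m)))
      {xs | |inner ℝ (batchDescent w xs) u| ≤ r / √(B : ℝ)} ≤ ENNReal.ofReal (5 * r) := by
  have hB' : (0 : ℝ) < B := by exact_mod_cast hB
  have hvn : ‖‖w‖⁻¹ • w‖ = 1 := by
    rw [norm_smul, norm_inv, norm_norm, inv_mul_cancel₀ (norm_ne_zero_iff.2 hw)]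
  have hbd : Measurable (fun xs : Fin B → EuclideanSpace ℝ (Fin m) => batchDescent w xs) := by
    have := measurable_batchDescent (m := m) (B := B)
    fun_prop
  have hSm : MeasurableSet {xs : Fin B → EuclideanSpace ℝ (Fin m) |
      |inner ℝ (batchDescent w xs) u| ≤ r / √(B : ℝ)} :=
    measurableSet_le (by fun_prop) measurable_const
  -- Resampling the components along `u` preserves the law of the batch; integrate over the fresh
  -- components first, then over the batch.
  have hmp := map_pi_resample_stdGaussian (B := B) hu
  rw [← hmp.measure_preimage hSm.nullMeasurableSet, Measure.prod_apply (hmp.measurable hSm)]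
  have hae : ∀ᵐ z ∂(Measure.pi fun _ : Fin B => stdGaussian (EuclideanSpace ℝ (Fin m))),
      ∀ b, label (z b) ≠ 0 :=
    ae_all_iff.2 fun b => (measurePreserving_eval
      (fun _ : Fin B => stdGaussian (EuclideanSpace ℝ (Fin m))) b).quasiMeasurePreserving.ae ae_label_ne_zero
  generalize hv : ‖w‖⁻¹ • w = v at hvn
  let F : EuclideanSpace ℝ (Fin m) → ENNReal := fun x =>
    ENNReal.ofReal (1 + Real.exp (inner ℝ v x) + Real.exp (-inner ℝ v x))
  have hFm : Measurable F := by fun_prop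
  have hF5 : ∫⁻ x, F x ∂stdGaussian (EuclideanSpace ℝ (Fin m)) ≤ 5 :=
    lintegral_one_add_exp_le hvn
  calc _ ≤ ∫⁻ z, ENNReal.ofReal (r * (B : ℝ)⁻¹) * ∑ b, F (z b)
        ∂(Measure.pi fun _ : Fin B => stdGaussian (EuclideanSpace ℝ (Fin m))) := by
        refine lintegral_mono_ae ?_
        filter_upwards [hae] with z hz
        refine (pi_gaussianReal_abs_inner_batchDescent_le hB hu huw hu0 hr hz).trans_eq ?_
        rw [hv, ← mul_assoc, ENNReal.ofReal_mul (by positivity),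
          ENNReal.ofReal_sum_of_nonneg (fun _ _ => by positivity)]
    _ = ENNReal.ofReal (r * (B : ℝ)⁻¹) *
          ∑ _b : Fin B, ∫⁻ x, F x ∂stdGaussian (EuclideanSpace ℝ (Fin m)) := by
        rw [lintegral_const_mul _ (by fun_prop), lintegral_finsetSum _ (fun _ _ => by fun_prop)]
        congr 1
        exact Finset.sum_congr rfl fun b _ => (measurePreserving_eval
          (fun _ : Fin B => stdGaussian (EuclideanSpace ℝ (Fin m))) b).lintegral_comp hFm
    _ ≤ ENNReal.ofReal (r * (B : ℝ)⁻¹) * ∑ _b : Fin B, 5 := by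
        gcongr
    _ = ENNReal.ofReal (5 * r) := by
        have h5 : (5 : ENNReal) = ENNReal.ofReal 5 := by norm_num
        rw [Finset.sum_const, Finset.card_univ, Fintype.card_fin, nsmul_eq_mul, h5,
          ← ENNReal.ofReal_natCast, ← ENNReal.ofReal_mul (by positivity),
          ← ENNReal.ofReal_mul (by positivity)]
        congr 1
        field_simp

end

/-- Double counting: integrate the number of sets `Q i` containing a point. This passes from single
coordinates to the norm without any joint law of the coordinates. -/
theorem measure_le_two_mul_of_half_covered {α : Type*} [MeasurableSpace α] (μ : Measure α) {d : ℕ}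
    (hd : 0 < d) {S : Set α} {Q : Fin d → Set α} (hS : MeasurableSet S)
    (hQ : ∀ i, MeasurableSet (Q i)) {p : ENNReal} (hp : ∀ i, μ (Q i) ≤ p) [∀ x i, Decidable (x ∈ Q i)]
    (h : ∀ x ∈ S, d ≤ 2 * (Finset.univ.filter fun i => x ∈ Q i).card) : μ S ≤ 2 * p := by
  have h1 : (d : ENNReal) * μ S ≤ d * (2 * p) := by
    calc (d : ENNReal) * μ S = ∫⁻ x, d * S.indicator 1 x ∂μ := by
          rw [lintegral_const_mul _ (measurable_one.indicator hS), lintegral_indicator_one hS]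
      _ ≤ ∫⁻ x, 2 * ∑ i, (Q i).indicator 1 x ∂μ := by
          refine lintegral_mono fun x => ?_
          by_cases hx : x ∈ S
          · have := h x hx
            rw [Set.indicator_of_mem hx]
            simp only [Set.indicator_apply, Pi.one_apply, mul_one, Finset.sum_boole]
            exact_mod_cast this
          · simp [hx]
      _ = 2 * ∑ i, μ (Q i) := by
          rw [lintegral_const_mul _ (Finset.measurable_sum _ fun i _ =>
            measurable_one.indicator (hQ i)),
            lintegral_finsetSum _ fun i _ => measurable_one.indicator (hQ i)]
          simp only [lintegral_indicator_one (hQ _)]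
      _ ≤ 2 * ∑ _i : Fin d, p := by
          gcongr
          exact hp _
      _ = d * (2 * p) := by
          rw [Finset.sum_const, Finset.card_univ, Fintype.card_fin, nsmul_eq_mul]
          ring
  exact (ENNReal.mul_le_mul_iff_right (by exact_mod_cast hd.ne') (ENNReal.natCast_ne_top d)).1 h1

/-- By Bessel's inequality, at most half of the coordinates can have square above `2τ²`. -/
theorem card_le_two_mul_card_abs_inner_le {V : Type*} [NormedAddCommGroup V] [InnerProductSpace ℝ V]
    {d : ℕ} {u : Fin d → V} (hu : Orthonormal ℝ u) {G : V} {τ : ℝ} (hτ : 0 < τ)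
    (hG : ‖G‖ ^ 2 ≤ τ ^ 2 * d) [∀ i, Decidable (|(inner ℝ G (u i) : ℝ)| ≤ √2 * τ)] :
    d ≤ 2 * (Finset.univ.filter fun i => |(inner ℝ G (u i) : ℝ)| ≤ √2 * τ).card := by
  set N := (Finset.univ.filter fun i => |(inner ℝ G (u i) : ℝ)| ≤ √2 * τ).card with hN
  have h1 := hu.sum_inner_products_le (s := Finset.univ) G
  have h2 : ∀ i, 2 * τ ^ 2 * (1 - if |(inner ℝ G (u i) : ℝ)| ≤ √2 * τ then 1 else 0) ≤
      ‖(inner ℝ (u i) G : ℝ)‖ ^ 2 := by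
    intro i
    split_ifs with h
    · simp only [sub_self, mul_zero]
      positivity
    · rw [real_inner_comm, Real.norm_eq_abs, sub_zero, mul_one]
      push Not at h
      have := pow_le_pow_left₀ (by positivity) h.le 2
      rwa [mul_pow, Real.sq_sqrt (by norm_num)] at this
  have h3 := Finset.sum_le_sum fun i (_ : i ∈ Finset.univ) => h2 i
  rw [← Finset.mul_sum, Finset.sum_sub_distrib, Finset.sum_boole, ← hN] at h3
  simp only [Finset.sum_const, Finset.card_univ, Fintype.card_fin, nsmul_eq_mul, mul_one] at h3
  have h4 : 2 * τ ^ 2 * ((d : ℝ) - N) ≤ τ ^ 2 * d := h3.trans (h1.trans hG)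
  have h5 : (d : ℝ) ≤ 2 * N := by
    have : 0 < τ ^ 2 := by positivity
    nlinarith
  exact_mod_cast h5

section

variable {m B : ℕ} [NeZero m]

/-- The factors are `2` from half covering, `5` from the one-coordinate bound, `√2` from the Bessel
threshold, and `e/64` from the norm threshold. -/
theorem escape_constant_le : 2 * (5 * (√2 * (Real.exp 1 / 64))) ≤ Real.exp (-(1 / 9)) := by
  have h1 : √2 ≤ 1.42 := by
    rw [Real.sqrt_le_left (by norm_num)]
    norm_num
  have h2 : Real.exp 1 ≤ 2.72 := by linarith [Real.exp_one_lt_d9]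
  have h3 := Real.add_one_le_exp (-(1 / 9 : ℝ))
  have h4 : √2 * Real.exp 1 ≤ 1.42 * 2.72 := by gcongr
  norm_num at h4
  linarith

/-- The stochastic part of the update is not too small with probability bounded below, uniformly in
the weight, the dimension and the batch size. -/
theorem measure_norm_batchDescent_le (hm : 3 ≤ m) (hB : 0 < B) {w : EuclideanSpace ℝ (Fin m)}
    (hw : w ≠ 0) :
    (Measure.pi fun _ : Fin B => stdGaussian (EuclideanSpace ℝ (Fin m)))
      {xs | ‖batchDescent w xs‖ ≤ Real.exp 1 / 64 * (√((m : ℝ) - 2) / √(B : ℝ))} ≤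
      ENNReal.ofReal (Real.exp (-(1 / 9))) := by
  classical
  have hB' : (0 : ℝ) < B := by exact_mod_cast hB
  have hm' : (3 : ℝ) ≤ m := by exact_mod_cast hm
  set e : EuclideanSpace ℝ (Fin m) := EuclideanSpace.single 0 1 with he
  -- `K` collects the directions that affect neither label nor output; its dimension is at least `m
  -- - 2`, the source of `√(m - 2)`.
  set K := (Submodule.span ℝ ({e, w} : Set (EuclideanSpace ℝ (Fin m))))ᗮ with hK
  set d := Module.finrank ℝ K with hd
  have hdm : m ≤ d + 2 := by
    have h1 := Submodule.finrank_add_finrank_orthogonal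
      (Submodule.span ℝ ({e, w} : Set (EuclideanSpace ℝ (Fin m))))
    have h2 : Module.finrank ℝ (Submodule.span ℝ ({e, w} : Set (EuclideanSpace ℝ (Fin m)))) ≤ 2 := by
      have := finrank_span_le_card (R := ℝ) ({e, w} : Set (EuclideanSpace ℝ (Fin m)))
      refine this.trans ?_
      rw [Set.toFinset_insert, Set.toFinset_singleton]
      exact Finset.card_le_two
    rw [finrank_euclideanSpace_fin, ← hK, ← hd] at h1
    omega
  have hdm' : (m : ℝ) - 2 ≤ d := by
    have : (m : ℝ) ≤ d + 2 := by exact_mod_cast hdm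
    linarith
  let u : Fin d → EuclideanSpace ℝ (Fin m) := fun i => (stdOrthonormalBasis ℝ K i : K)
  have hu : Orthonormal ℝ u :=
    (stdOrthonormalBasis ℝ K).orthonormal.comp_linearIsometry K.subtypeₗᵢ
  have huK : ∀ i, ∀ v ∈ ({e, w} : Set (EuclideanSpace ℝ (Fin m))), inner ℝ v (u i) = 0 :=
    fun i v hv => (Submodule.mem_orthogonal _ _).1 (stdOrthonormalBasis ℝ K i).2 v
      (Submodule.subset_span hv)
  have hu0 : ∀ i, u i 0 = 0 := fun i => by
    rw [← inner_single_zero]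
    exact huK i e (by simp)
  have huw : ∀ i, inner ℝ w (u i) = 0 := fun i => huK i w (by simp)
  have hbd : Measurable (fun xs : Fin B → EuclideanSpace ℝ (Fin m) => batchDescent w xs) := by
    have := measurable_batchDescent (m := m) (B := B)
    fun_prop
  set c := Real.exp 1 / 64 with hc
  have hc0 : 0 < c := by positivity
  -- The Bessel lemma is applied with `τ = c / √B`.
  refine (measure_le_two_mul_of_half_covered _ (by omega : 0 < d)
    (Q := fun i => {xs | |inner ℝ (batchDescent w xs) (u i)| ≤ √2 * c / √(B : ℝ)})
    (measurableSet_le (by fun_prop) measurable_const)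
    (fun i => measurableSet_le (by fun_prop) measurable_const)
    (fun i => measure_abs_inner_batchDescent_le hB hw (hu.1 i) (huw i) (hu0 i) (by positivity))
    fun xs hxs => ?_).trans ?_
  · have hxs : ‖batchDescent w xs‖ ≤ c * (√((m : ℝ) - 2) / √(B : ℝ)) := hxs
    simp only [Set.mem_ofPred_eq, mul_div_assoc]
    refine card_le_two_mul_card_abs_inner_le hu (by positivity) ?_
    calc ‖batchDescent w xs‖ ^ 2 ≤ (c * (√((m : ℝ) - 2) / √(B : ℝ))) ^ 2 := by gcongr
      _ = (c / √(B : ℝ)) ^ 2 * ((m : ℝ) - 2) := by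
        rw [mul_pow, div_pow √_, Real.sq_sqrt (by linarith), div_pow c]
        ring
      _ ≤ _ := by gcongr
  · rw [show (2 : ENNReal) = ENNReal.ofReal 2 by norm_num, ← ENNReal.ofReal_mul (by norm_num)]
    exact ENNReal.ofReal_le_ofReal escape_constant_le

end

/-! ### Independence of a batch from the past, and runs of consecutive batches -/

theorem Indep.measure_inter_preimage_le {Ω α β : Type*} {mF mΩ : MeasurableSpace Ω}
    [MeasurableSpace α] [MeasurableSpace β] {μ : Measure Ω} [IsProbabilityMeasure μ]
    (hF : mF ≤ mΩ) {Y : Ω → α} {Z : Ω → β} (hY : Measurable[mF] Y) (hZ : Measurable Z)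
    (hind : Indep mF (MeasurableSpace.comap Z inferInstance) μ) {A : Set Ω}
    (hA : MeasurableSet[mF] A) {S : Set (α × β)} (hS : MeasurableSet S) {p : ENNReal}
    (hp : ∀ y, μ.map Z (Prod.mk y ⁻¹' S) ≤ p) :
    μ (A ∩ {ω | (Y ω, Z ω) ∈ S}) ≤ p * μ A := by
  -- Adjoining the truth value of `ω ∈ A` to `Y` encodes the past event in one variable independent
  -- of `Z`, so Fubini applies without conditional expectations.
  have hAY : Measurable[mF] fun ω => (Y ω, ω ∈ A) := hY.prodMk ((@measurable_mem _ A mF).2 hA)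
  have hAY' : Measurable fun ω => (Y ω, ω ∈ A) := hAY.mono hF le_rfl
  have hi : IndepFun (fun ω => (Y ω, ω ∈ A)) Z μ := by
    rw [IndepFun_iff_Indep]
    exact indep_of_indep_of_le_left hind hAY.comap_le
  have hlaw := hi.map_prod_eq_prod_map_map hAY'.aemeasurable hZ.aemeasurable
  have := Measure.isProbabilityMeasure_map (μ := μ) hZ.aemeasurable
  set S' : Set ((α × Prop) × β) := {q | q.1.2 ∧ (q.1.1, q.2) ∈ S} with hS'
  have hT : MeasurableSet {q : α × Prop | q.2} := measurableSet_setOfPred.2 measurable_snd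
  have hS'm : MeasurableSet S' := by
    have h1 : MeasurableSet {q : (α × Prop) × β | q.1.2} := measurable_fst hT
    have h2 : Measurable fun q : (α × Prop) × β => (q.1.1, q.2) := by fun_prop
    exact h1.inter (h2 hS)
  have h1 : μ (A ∩ {ω | (Y ω, Z ω) ∈ S}) = μ.map (fun ω => ((Y ω, ω ∈ A), Z ω)) S' := by
    rw [Measure.map_apply (hAY'.prodMk hZ) hS'm]
    rfl
  rw [h1, hlaw, Measure.prod_apply hS'm]
  calc _ ≤ ∫⁻ q, {q : α × Prop | q.2}.indicator (fun _ => p) q ∂μ.map (fun ω => (Y ω, ω ∈ A)) := by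
        refine lintegral_mono fun q => ?_
        by_cases hq : q.2
        · rw [Set.indicator_of_mem (show q ∈ {q : α × Prop | q.2} from hq)]
          refine (measure_mono ?_).trans (hp q.1)
          rintro z ⟨_, hz⟩
          exact hz
        · have : Prod.mk q ⁻¹' S' = ∅ := by
            ext z
            simp [hS', hq]
          simp [this]
    _ = p * μ A := by
        rw [lintegral_indicator_const hT, Measure.map_apply hAY' hT]
        rfl

section

variable {Ω : Type*} {m B : ℕ}

/-- The `σ`-algebra generated by the batches used before iteration `t`. -/
abbrev pastBatches (X : ℕ → Fin B → Ω → EuclideanSpace ℝ (Fin m)) (t : ℕ) : MeasurableSpace Ω :=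
  ⨆ p ∈ {p : ℕ × Fin B | p.1 < t}, MeasurableSpace.comap (X p.1 p.2) inferInstance

variable {X : ℕ → Fin B → Ω → EuclideanSpace ℝ (Fin m)}

theorem pastBatches_mono {s t : ℕ} (h : s ≤ t) : pastBatches X s ≤ pastBatches X t :=
  biSup_mono fun _ hp => lt_of_lt_of_le hp h

theorem measurable_batch_pastBatches {s t : ℕ} (h : s < t) :
    Measurable[pastBatches X t] fun ω b => X s b ω := by
  rw [@measurable_pi_iff]
  intro b
  rw [measurable_iff_comap_le]
  exact le_iSup₂_of_le (f := fun (p : ℕ × Fin B) (_ : p ∈ {p : ℕ × Fin B | p.1 < t}) =>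
    MeasurableSpace.comap (X p.1 p.2) inferInstance) (s, b) h le_rfl

variable [mΩ : MeasurableSpace Ω] {μ : Measure Ω}

theorem pastBatches_le (hX : ∀ t b, Measurable (X t b)) (t : ℕ) : pastBatches X t ≤ mΩ :=
  iSup₂_le fun p _ => (hX p.1 p.2).comap_le

theorem indep_pastBatches (hX : ∀ t b, Measurable (X t b))
    (hX_indep : iIndepFun (fun p : ℕ × Fin B => X p.1 p.2) μ) (t : ℕ) :
    Indep (pastBatches X t)
      (MeasurableSpace.comap (fun ω b => X t b ω) inferInstance) μ := by
  have h := indep_iSup_of_disjoint (fun p : ℕ × Fin B => (hX p.1 p.2).comap_le) hX_indep.iIndep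
    (S := {p : ℕ × Fin B | p.1 < t}) (T := {p : ℕ × Fin B | p.1 = t})
    (Set.disjoint_left.2 fun p h1 h2 => (ne_of_lt h1) h2)
  refine indep_of_indep_of_le_right h ?_
  rw [← measurable_iff_comap_le, @measurable_pi_iff]
  intro b
  rw [measurable_iff_comap_le]
  exact le_iSup₂_of_le (f := fun (p : ℕ × Fin B) (_ : p ∈ {p : ℕ × Fin B | p.1 = t}) =>
    MeasurableSpace.comap (X p.1 p.2) inferInstance) (t, b) rfl le_rfl

variable [IsProbabilityMeasure μ]

theorem map_batch (hX : ∀ t b, Measurable (X t b))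
    (hX_law : ∀ t b, μ.map (X t b) = stdGaussian (EuclideanSpace ℝ (Fin m)))
    (hX_indep : iIndepFun (fun p : ℕ × Fin B => X p.1 p.2) μ) (t : ℕ) :
    μ.map (fun ω b => X t b ω) =
      Measure.pi fun _ : Fin B => stdGaussian (EuclideanSpace ℝ (Fin m)) := by
  have h := hX_indep.precomp (g := fun b : Fin B => (t, b)) (fun _ _ h => (Prod.mk.inj h).2)
  have h2 := (iIndepFun_iff_map_fun_eq_pi_map fun b => (hX t b).aemeasurable).1 h
  rw [h2]
  simp only [hX_law]

variable {w : ℕ → Ω → EuclideanSpace ℝ (Fin m)}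
  {S : Set (EuclideanSpace ℝ (Fin m) × (Fin B → EuclideanSpace ℝ (Fin m)))} {p : ENNReal}

/-- If, whatever the weight, a batch satisfies `S` with probability at most `p`, then `n`
consecutive batches satisfy it with probability at most `p ^ n`, given the past. -/
theorem measure_inter_consecutive_le (hX : ∀ t b, Measurable (X t b))
    (hX_law : ∀ t b, μ.map (X t b) = stdGaussian (EuclideanSpace ℝ (Fin m)))
    (hX_indep : iIndepFun (fun p : ℕ × Fin B => X p.1 p.2) μ)
    (hw : ∀ t, Measurable[pastBatches X t] (w t)) (hS : MeasurableSet S)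
    (hp : ∀ y, (Measure.pi fun _ : Fin B => stdGaussian (EuclideanSpace ℝ (Fin m)))
      (Prod.mk y ⁻¹' S) ≤ p) (t : ℕ) {A : Set Ω} (hA : MeasurableSet[pastBatches X t] A) (n : ℕ) :
    μ (A ∩ {ω | ∀ i < n, (w (t + i) ω, fun b => X (t + i) b ω) ∈ S}) ≤ p ^ n * μ A ∧
      MeasurableSet[pastBatches X (t + n)]
        (A ∩ {ω | ∀ i < n, (w (t + i) ω, fun b => X (t + i) b ω) ∈ S}) := by
  induction n with
  | zero => simpa using hA
  | succ n ih =>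
    have heq : A ∩ {ω | ∀ i < n + 1, (w (t + i) ω, fun b => X (t + i) b ω) ∈ S} =
        (A ∩ {ω | ∀ i < n, (w (t + i) ω, fun b => X (t + i) b ω) ∈ S}) ∩
          {ω | (w (t + n) ω, fun b => X (t + n) b ω) ∈ S} := by
      ext ω
      simp only [Nat.lt_succ_iff_lt_or_eq, or_imp, forall_and, forall_eq, Set.mem_inter_iff,
        Set.mem_ofPred_eq, and_assoc]
    rw [heq]
    constructor
    · refine (Indep.measure_inter_preimage_le (pastBatches_le hX _) (hw (t + n))
        (measurable_pi_lambda _ (hX (t + n))) (indep_pastBatches hX hX_indep (t + n)) ih.2 hS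
        (p := p) fun y => ?_).trans ?_
      · rw [map_batch hX hX_law hX_indep]
        exact hp y
      · rw [pow_succ', mul_assoc]
        gcongr
        exact ih.1
    · have h1 : pastBatches X (t + n) ≤ pastBatches X (t + (n + 1)) := pastBatches_mono (by omega)
      refine MeasurableSet.inter (h1 _ ih.2) ?_
      have h2 : Measurable[pastBatches X (t + (n + 1))]
          fun ω => (w (t + n) ω, fun b => X (t + n) b ω) :=
        ((hw (t + n)).mono h1 le_rfl).prodMk (measurable_batch_pastBatches (by omega))
      exact h2 hS

/-- The window `κ (w T ω)` is random but determined by the past of `T`. Splitting over its countably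
many values reduces to windows of fixed position and length. -/
theorem measure_consecutive_le (hX : ∀ t b, Measurable (X t b))
    (hX_law : ∀ t b, μ.map (X t b) = stdGaussian (EuclideanSpace ℝ (Fin m)))
    (hX_indep : iIndepFun (fun p : ℕ × Fin B => X p.1 p.2) μ)
    (hw : ∀ t, Measurable[pastBatches X t] (w t)) (hS : MeasurableSet S)
    (hp : ∀ y, (Measure.pi fun _ : Fin B => stdGaussian (EuclideanSpace ℝ (Fin m)))
      (Prod.mk y ⁻¹' S) ≤ p) (T : ℕ) {κ : EuclideanSpace ℝ (Fin m) → ℕ × ℕ} (hκ : Measurable κ)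
    {δ : ENNReal} (hδ : ∀ v, p ^ ((κ v).2 - (κ v).1) ≤ δ) :
    μ {ω | ∀ j < (κ (w T ω)).2, (κ (w T ω)).1 ≤ j →
      (w (T + j) ω, fun b => X (T + j) b ω) ∈ S} ≤ δ := by
  have hκw : Measurable[pastBatches X T] fun ω => κ (w T ω) := hκ.comp (hw T)
  set A : ℕ × ℕ → Set Ω := fun c => {ω | κ (w T ω) = c} with hA
  have hAm : ∀ c, MeasurableSet[pastBatches X T] (A c) := fun c =>
    hκw (measurableSet_singleton c)
  have hAm' : ∀ c, MeasurableSet (A c) := fun c => pastBatches_le hX T _ (hAm c)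
  have hsum : ∑' c, μ (A c) = 1 := by
    rw [← measure_iUnion (fun c c' h => Set.disjoint_left.2 fun ω h1 h2 => h (h1.symm.trans h2)) hAm']
    have : ⋃ c, A c = Set.univ := Set.eq_univ_of_forall fun ω => Set.mem_iUnion.2 ⟨_, rfl⟩
    rw [this, measure_univ]
  calc _ ≤ μ (⋃ c : ℕ × ℕ, A c ∩ {ω | ∀ i < c.2 - c.1,
          (w (T + c.1 + i) ω, fun b => X (T + c.1 + i) b ω) ∈ S}) := by
        refine measure_mono fun ω hω => Set.mem_iUnion.2 ⟨κ (w T ω), rfl, fun i hi => ?_⟩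
        have := hω ((κ (w T ω)).1 + i) (by omega) (by omega)
        rwa [← add_assoc] at this
    _ ≤ ∑' c : ℕ × ℕ, μ (A c ∩ {ω | ∀ i < c.2 - c.1,
          (w (T + c.1 + i) ω, fun b => X (T + c.1 + i) b ω) ∈ S}) := measure_iUnion_le _
    _ ≤ ∑' c : ℕ × ℕ, δ * μ (A c) := by
        refine ENNReal.tsum_le_tsum fun c => ?_
        rcases (A c).eq_empty_or_nonempty with h | ⟨ω, hω⟩
        · simp [h]
        have hc : κ (w T ω) = c := hω
        refine ((measure_inter_consecutive_le hX hX_law hX_indep hw hS hp (T + c.1)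
          (pastBatches_mono (Nat.le_add_right _ _) _ (hAm c)) (c.2 - c.1)).1).trans ?_
        gcongr
        rw [← hc]
        exact hδ _
    _ = δ := by rw [ENNReal.tsum_mul_left, hsum, mul_one]

end

/-! ### Decay of the norm and the count of iterations -/

section

variable {m B : ℕ}

/-- The number of iterations after which the norm has decayed to its threshold. -/
noncomputable def decayIterations (m B : ℕ) (η wd ε : ℝ) (w : EuclideanSpace ℝ (Fin m)) : ℕ :=
  ⌊max 0 (1 / (2 * (η * wd - 2 * ε ^ 2)) *
    Real.log (64 * ‖w‖ ^ 2 * ε * √(B : ℝ) / (η * √((m : ℝ) - 2))))⌋₊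

/-- The decay time is rounded down and the total up, so the remaining window keeps its full length.
-/
theorem nine_mul_log_le (η wd ε δ : ℝ) (hδ : 0 < δ) (hδ1 : δ < 1)
    (w : EuclideanSpace ℝ (Fin m)) :
    9 * Real.log (1 / δ) ≤
      (escapeIterations m B η wd ε δ w - decayIterations m B η wd ε w : ℕ) := by
  have hl : 0 ≤ Real.log (1 / δ) := Real.log_nonneg (by rw [le_div_iff₀ hδ]; linarith)
  have h1 : (decayIterations m B η wd ε w : ℝ) ≤ _ := Nat.floor_le (le_max_left _ _)
  have h2 : _ ≤ (escapeIterations m B η wd ε δ w : ℝ) := Nat.le_ceil _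
  have h3 : decayIterations m B η wd ε w ≤ escapeIterations m B η wd ε δ w := by
    have : (decayIterations m B η wd ε w : ℝ) ≤ escapeIterations m B η wd ε δ w := by linarith
    exact_mod_cast this
  rw [Nat.cast_sub h3]
  linarith

theorem exp_pow_le_of_nine_mul_log_le {δ : ℝ} (hδ : 0 < δ) {n : ℕ}
    (h : 9 * Real.log (1 / δ) ≤ n) : Real.exp (-(1 / 9)) ^ n ≤ δ := by
  rw [← Real.exp_nat_mul]
  calc Real.exp (n * -(1 / 9)) ≤ Real.exp (Real.log δ) := by
        rw [one_div, Real.log_inv] at h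
        apply Real.exp_le_exp.2
        linarith
    _ = δ := Real.exp_log hδ

/-- This is `2 - 2s ≤ exp (1 - 2s)`. It absorbs the factor `exp (2s)` lost by rounding the decay
time down. -/
theorem one_sub_mul_exp_le (s : ℝ) : (1 - s) * Real.exp (2 * s) ≤ Real.exp 1 / 2 := by
  have h1 := Real.add_one_le_exp (1 - 2 * s)
  have h2 : Real.exp (1 - 2 * s) * Real.exp (2 * s) = Real.exp 1 := by
    rw [← Real.exp_add]
    ring_nf
  have h3 : (1 - 2 * s + 1) * Real.exp (2 * s) ≤ Real.exp (1 - 2 * s) * Real.exp (2 * s) := by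
    gcongr
  linarith

theorem measurable_decayIterations (η wd ε : ℝ) : Measurable (decayIterations m B η wd ε) := by
  unfold decayIterations
  exact Nat.measurable_floor.comp (by fun_prop)

theorem measurable_escapeIterations (η wd ε δ : ℝ) :
    Measurable (escapeIterations m B η wd ε δ) := by
  unfold escapeIterations
  exact Nat.measurable_ceil.comp (by fun_prop)

variable [NeZero m]

/-- As long as the training error stays small, the norm decays geometrically, and after
`decayIterations` steps the stochastic parts of the updates have to be small. -/
theorem norm_batchDescent_le_of_trainError_le (hm : 3 ≤ m) (hB : 0 < B) {η wd ε : ℝ} (hη : 0 < η)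
    (hε0 : 0 < ε) (hε : ε ≤ Real.pi / 4) (hwd : 2 * ε ^ 2 < η * wd)
    {v : ℕ → EuclideanSpace ℝ (Fin m)} {xs : ℕ → Fin B → EuclideanSpace ℝ (Fin m)}
    (hv : ∀ j, v (j + 1) = sgdStep η wd (v j) (xs j)) {N : ℕ}
    (hN : ∀ j ≤ N, trainError (v j) ≤ ε / Real.pi) {j : ℕ} (hj : j < N)
    (hdecay : decayIterations m B η wd ε (v 0) ≤ j) :
    v j ≠ 0 ∧
      ‖batchDescent (v j) (xs j)‖ ≤ Real.exp 1 / 64 * (√((m : ℝ) - 2) / √(B : ℝ)) := by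
  have hv0 : ∀ j ≤ N, v j ≠ 0 := fun j hj => ne_zero_of_trainError_le hε (hN j hj)
  have hstep : ∀ j < N, η * wd < 1 ∧ ‖v (j + 1)‖ ≤ (1 - (η * wd - 2 * ε ^ 2)) * ‖v j‖ ∧
      η * ‖batchDescent (v j) (xs j)‖ ≤ 2 * ε * (1 - (η * wd - 2 * ε ^ 2)) * ‖v j‖ ^ 2 := by
    intro j hj
    have h1 := hv0 (j + 1) hj
    have h2 := hN (j + 1) hj
    rw [hv] at h1 h2 ⊢
    exact sgdStep_of_trainError_le (by omega) hB hη hε hwd (hv0 j hj.le) h1 (hN j hj.le) h2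
  refine ⟨hv0 j hj.le, ?_⟩
  set s := η * wd - 2 * ε ^ 2 with hs
  have hs0 : 0 < s := by linarith
  have hs1 : s < 1 := by nlinarith [(hstep j hj).1]
  have hgeom : ∀ i ≤ N, ‖v i‖ ≤ (1 - s) ^ i * ‖v 0‖ := by
    intro i
    induction i with
    | zero => simp
    | succ i ih =>
      intro hi
      refine (hstep i hi).2.1.trans ?_
      rw [pow_succ', mul_assoc]
      exact mul_le_mul_of_nonneg_left (ih (by omega)) (by linarith)
  have hn : 0 < ‖v 0‖ := norm_pos_iff.2 (hv0 0 (Nat.zero_le _))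
  have hB' : (0 : ℝ) < √(B : ℝ) := Real.sqrt_pos.2 (by exact_mod_cast hB)
  have hm' : 0 < √((m : ℝ) - 2) := Real.sqrt_pos.2 (by
    have : (3 : ℝ) ≤ m := by exact_mod_cast hm
    linarith)
  set R := 64 * ‖v 0‖ ^ 2 * ε * √(B : ℝ) / (η * √((m : ℝ) - 2)) with hR
  have hR0 : 0 < R := by positivity
  set K := 1 / (2 * s) * Real.log R with hK
  -- The floor may lose one step, at the cost of a factor `exp (2s)` in the squared norm.
  have hjK : K - 1 ≤ j := by
    have h1 : max 0 K < (decayIterations m B η wd ε (v 0) : ℝ) + 1 := Nat.lt_floor_add_one _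
    have h2 : (decayIterations m B η wd ε (v 0) : ℝ) ≤ j := by exact_mod_cast hdecay
    linarith [le_max_right 0 K]
  have hpow : ((1 - s) ^ j) ^ 2 ≤ Real.exp (2 * s) / R := by
    have h1 : (1 - s) ^ j ≤ Real.exp (-s) ^ j :=
      pow_le_pow_left₀ (by linarith) (Real.one_sub_le_exp_neg s) j
    calc ((1 - s) ^ j) ^ 2 ≤ (Real.exp (-s) ^ j) ^ 2 :=
          pow_le_pow_left₀ (pow_nonneg (by linarith) j) h1 2
      _ = Real.exp (-(2 * s * j)) := by
          rw [← pow_mul, ← Real.exp_nat_mul]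
          push_cast
          ring_nf
      _ ≤ Real.exp (2 * s - Real.log R) := by
          apply Real.exp_le_exp.2
          have h2 : 2 * s * K = Real.log R := by
            rw [hK]
            field_simp
          nlinarith
      _ = _ := by rw [Real.exp_sub, Real.exp_log hR0]
  have hnorm : ‖v j‖ ^ 2 ≤ Real.exp (2 * s) / R * ‖v 0‖ ^ 2 := by
    calc ‖v j‖ ^ 2 ≤ ((1 - s) ^ j * ‖v 0‖) ^ 2 :=
          pow_le_pow_left₀ (norm_nonneg _) (hgeom j hj.le) 2
      _ = ((1 - s) ^ j) ^ 2 * ‖v 0‖ ^ 2 := mul_pow _ _ _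
      _ ≤ _ := by gcongr
  refine le_of_mul_le_mul_left ?_ hη
  calc η * ‖batchDescent (v j) (xs j)‖ ≤ 2 * ε * (1 - s) * ‖v j‖ ^ 2 := (hstep j hj).2.2
    _ ≤ 2 * ε * (1 - s) * (Real.exp (2 * s) / R * ‖v 0‖ ^ 2) :=
        mul_le_mul_of_nonneg_left hnorm (mul_nonneg (by positivity) (by linarith))
    _ = 2 * ε * ((1 - s) * Real.exp (2 * s)) * (‖v 0‖ ^ 2 / R) := by ring
    _ ≤ 2 * ε * (Real.exp 1 / 2) * (‖v 0‖ ^ 2 / R) := by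
        gcongr
        exact one_sub_mul_exp_le s
    _ = _ := by
        rw [hR]
        field_simp

variable {Ω : Type*} {X : ℕ → Fin B → Ω → EuclideanSpace ℝ (Fin m)}
  {w : ℕ → Ω → EuclideanSpace ℝ (Fin m)} {η wd : ℝ} {w₀ : EuclideanSpace ℝ (Fin m)}

theorem measurable_sgdIterate_pastBatches (hB : 0 < B)
    (hw : ∀ t ω, w t ω = sgdIterate η wd w₀ (fun s b => X s b ω) t) (t : ℕ) :
    Measurable[pastBatches X t] (w t) := by
  induction t with
  | zero =>
    have : w 0 = fun _ => w₀ := funext fun ω => hw 0 ω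
    rw [this]
    exact measurable_const
  | succ t ih =>
    have h1 : w (t + 1) = fun ω => sgdStep η wd (w t ω) (fun b => X t b ω) := by
      ext1 ω
      rw [hw (t + 1), hw t, sgdIterate]
    have h2 : Measurable[pastBatches X (t + 1)] fun ω => (w t ω, fun b => X t b ω) :=
      (ih.mono (pastBatches_mono t.le_succ) le_rfl).prodMk
        (measurable_batch_pastBatches t.lt_succ_self)
    rw [h1]
    exact (measurable_sgdStep hB η wd).comp h2

/-- The training error stays small for `escapeIterations` steps with probability at most `δ`. -/
theorem measure_forall_trainError_le [MeasurableSpace Ω] {μ : Measure Ω} [IsProbabilityMeasure μ]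
    (hm : 3 ≤ m) (hB : 0 < B) (hη : 0 < η) (hX : ∀ t b, Measurable (X t b))
    (hX_law : ∀ t b, μ.map (X t b) = stdGaussian (EuclideanSpace ℝ (Fin m)))
    (hX_indep : iIndepFun (fun p : ℕ × Fin B => X p.1 p.2) μ)
    (hw : ∀ t ω, w t ω = sgdIterate η wd w₀ (fun s b => X s b ω) t) (T₀ : ℕ) {ε δ : ℝ}
    (hε0 : 0 < ε) (hε : ε ≤ Real.pi / 4) (hwd : 2 * ε ^ 2 < η * wd) (hδ : 0 < δ) (hδ1 : δ < 1) :
    μ {ω | ∀ t, T₀ ≤ t → t ≤ T₀ + escapeIterations m B η wd ε δ (w T₀ ω) →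
      trainError (w t ω) ≤ ε / Real.pi} ≤ ENNReal.ofReal δ := by
  set c := Real.exp 1 / 64 * (√((m : ℝ) - 2) / √(B : ℝ)) with hc
  -- Requiring a nonzero weight empties the slice at `0`, where `batchDescent` has no
  -- anti-concentration bound to use.
  set S : Set (EuclideanSpace ℝ (Fin m) × (Fin B → EuclideanSpace ℝ (Fin m))) :=
    {q | q.1 ≠ 0 ∧ ‖batchDescent q.1 q.2‖ ≤ c} with hS
  have hSm : MeasurableSet S := by
    have h1 : MeasurableSet {q : EuclideanSpace ℝ (Fin m) × (Fin B → EuclideanSpace ℝ (Fin m)) |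
        q.1 ≠ 0} := measurable_fst (measurableSet_singleton 0).compl
    have h := measurable_batchDescent (m := m) (B := B)
    have h2 : MeasurableSet {q : EuclideanSpace ℝ (Fin m) × (Fin B → EuclideanSpace ℝ (Fin m)) |
        ‖batchDescent q.1 q.2‖ ≤ c} := measurableSet_le (by fun_prop) measurable_const
    exact h1.inter h2
  have hp : ∀ y, (Measure.pi fun _ : Fin B => stdGaussian (EuclideanSpace ℝ (Fin m)))
      (Prod.mk y ⁻¹' S) ≤ ENNReal.ofReal (Real.exp (-(1 / 9))) := by
    intro y
    rcases eq_or_ne y 0 with rfl | hy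
    · have : Prod.mk (0 : EuclideanSpace ℝ (Fin m)) ⁻¹' S = ∅ := by
        ext z
        simp [hS]
      simp [this]
    · refine (measure_mono ?_).trans (measure_norm_batchDescent_le hm hB hy)
      rintro z ⟨_, hz⟩
      exact hz
  refine (measure_mono ?_).trans (measure_consecutive_le hX hX_law hX_indep
    (measurable_sgdIterate_pastBatches hB hw) hSm hp T₀
    (κ := fun v => (decayIterations m B η wd ε v, escapeIterations m B η wd ε δ v))
    ((measurable_decayIterations η wd ε).prodMk (measurable_escapeIterations η wd ε δ))
    (δ := ENNReal.ofReal δ) fun v => ?_)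
  · intro ω hω j hj hdecay
    refine norm_batchDescent_le_of_trainError_le hm hB hη hε0 hε hwd
      (v := fun j => w (T₀ + j) ω) (xs := fun j b => X (T₀ + j) b ω) (fun i => ?_)
      (fun i hi => hω (T₀ + i) (Nat.le_add_right _ _) (Nat.add_le_add_left hi _)) hj hdecay
    simp only [hw]
    rw [← add_assoc, sgdIterate]
  · rw [← ENNReal.ofReal_pow (Real.exp_pos _).le]
    exact ENNReal.ofReal_le_ofReal
      (exp_pow_le_of_nine_mul_log_le hδ (nine_mul_log_le η wd ε δ hδ hδ1 v))

end

/-! ### The nonconvergence theorem -/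

theorem theorem3p1 {Ω : Type*} [MeasurableSpace Ω] (μ : Measure Ω) [IsProbabilityMeasure μ]
    (m B : ℕ) [NeZero m] (hm : 3 ≤ m) (hB : 0 < B)
    (η wd : ℝ) (hη : 0 < η) (hwd : 0 < wd)
    (w₀ : EuclideanSpace ℝ (Fin m)) (hw₀ : w₀ ≠ 0)
    (X : ℕ → Fin B → Ω → EuclideanSpace ℝ (Fin m))
    (hX_meas : ∀ t b, Measurable (X t b))
    (hX_law : ∀ t b, μ.map (X t b) = stdGaussian (EuclideanSpace ℝ (Fin m)))
    (hX_indep : iIndepFun (fun p : ℕ × Fin B => X p.1 p.2) μ)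
    (w : ℕ → Ω → EuclideanSpace ℝ (Fin m))
    (hw : ∀ t ω, w t ω = sgdIterate η wd w₀ (fun s b => X s b ω) t) :
    (∀ (T₀ : ℕ) (ε δ : ℝ), 0 < ε → ε ≤ Real.pi / 4 → 2 * ε ^ 2 < η * wd → 0 < δ → δ < 1 →
      ENNReal.ofReal (1 - δ) ≤
        μ {ω | ∃ t, T₀ ≤ t ∧ t ≤ T₀ + escapeIterations m B η wd ε δ (w T₀ ω) ∧
          ε / Real.pi < trainError (w t ω)}) ∧
    (∀ᵐ ω ∂μ, min √(η * wd / 2) (Real.pi / 4) / Real.pi ≤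
      limsup (fun t => trainError (w t ω)) atTop) := by
  have hbad := fun (T₀ : ℕ) (ε δ : ℝ) (h1 : 0 < ε) (h2 : ε ≤ Real.pi / 4)
    (h3 : 2 * ε ^ 2 < η * wd) (h4 : 0 < δ) (h5 : δ < 1) =>
    measure_forall_trainError_le hm hB hη hX_meas hX_law hX_indep hw T₀ h1 h2 h3 h4 h5
  constructor
  · intro T₀ ε δ h1 h2 h3 h4 h5
    have h6 := hbad T₀ ε δ h1 h2 h3 h4 h5
    set G := {ω | ∃ t, T₀ ≤ t ∧ t ≤ T₀ + escapeIterations m B η wd ε δ (w T₀ ω) ∧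
      ε / Real.pi < trainError (w t ω)} with hG
    have hGc : Gᶜ = {ω | ∀ t, T₀ ≤ t → t ≤ T₀ + escapeIterations m B η wd ε δ (w T₀ ω) →
        trainError (w t ω) ≤ ε / Real.pi} := by
      ext ω
      simp [hG]
    rw [← hGc] at h6
    -- Subadditivity is enough, so `G` need not be shown measurable.
    have h7 : (1 : ENNReal) ≤ μ G + μ Gᶜ := by
      rw [← measure_univ (μ := μ), ← Set.union_compl_self G]
      exact measure_union_le _ _
    rw [ENNReal.ofReal_sub _ h4.le, ENNReal.ofReal_one, tsub_le_iff_right]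
    exact h7.trans (by gcongr)
  · set M := min √(η * wd / 2) (Real.pi / 4) with hM
    have hM0 : 0 < M := lt_min (Real.sqrt_pos.2 (by positivity)) (by positivity)
    have hlarge : ∀ ε, 0 < ε → ε < M →
        ∀ᵐ ω ∂μ, ∀ T₀, ∃ t ≥ T₀, ε / Real.pi ≤ trainError (w t ω) := by
      intro ε hε0 hεM
      rw [ae_all_iff]
      intro T₀
      rw [ae_iff]
      have hε2 : 2 * ε ^ 2 < η * wd := by
        have h1 : ε < √(η * wd / 2) := hεM.trans_le (min_le_left _ _)
        have h2 := (Real.lt_sqrt hε0.le).1 h1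
        linarith
      -- Error small at all times from `T₀` on lies in the bad event for every `δ`, hence is a null
      -- event.
      have hle : ∀ δ : ℝ, 0 < δ → δ < 1 →
          μ {ω | ¬∃ t ≥ T₀, ε / Real.pi ≤ trainError (w t ω)} ≤ ENNReal.ofReal δ := by
        intro δ h1 h2
        refine (measure_mono ?_).trans
          (hbad T₀ ε δ hε0 (hεM.le.trans (min_le_right _ _)) hε2 h1 h2)
        intro ω hω t ht _
        by_contra! h
        exact hω ⟨t, ht, h.le⟩
      refine le_antisymm ?_ zero_le
      refine ENNReal.le_of_forall_pos_le_add fun r hr _ => ?_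
      rw [zero_add]
      have h1 : (0 : ℝ) < min r 2⁻¹ := lt_min (by exact_mod_cast hr) (by norm_num)
      refine (hle (min r 2⁻¹) h1 ((min_le_right _ _).trans_lt (by norm_num))).trans ?_
      rw [← ENNReal.ofReal_coe_nnreal]
      exact ENNReal.ofReal_le_ofReal (min_le_left _ _)
    -- A sequence increasing to `M` keeps the exceptional set a countable union of null sets.
    obtain ⟨ε, _, hε, hεlim⟩ := exists_seq_strictMono_tendsto' hM0
    have hall : ∀ᵐ ω ∂μ, ∀ n T₀, ∃ t ≥ T₀, ε n / Real.pi ≤ trainError (w t ω) :=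
      ae_all_iff.2 fun n => hlarge (ε n) (hε n).1 (hε n).2
    filter_upwards [hall] with ω hω
    refine le_of_tendsto' (hεlim.div_const Real.pi) fun n => ?_
    refine le_limsup_of_frequently_le (frequently_atTop.2 (hω n)) ?_
    exact isBoundedUnder_of ⟨1, fun t => trainError_le_one _⟩
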